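/- **Theorem (weighted fractional Leibniz rule).** Let $n\ge 1$, and let $P_j=\phi(2^{-j}D)$, $j\in\mathbb Z$, $D=\sqrt{-\Delta}$, be the homogeneous Littlewood–Paley projections in the space variable $x\in\mathbb R^n$, where $\phi\in C_c^\infty((0,\infty))$ is real valued with $\sum_{j\in\mathbb Z}\phi(2^{-j}r)=1$ for $r>0$. Let $s>0$, $\lambda\in[1,\infty]$, $q_0,q_1,q_2\in(1,\infty)$, $p_1,p_2\in(1,\infty]$ with $$\frac1{q_0}=\frac1{q_1}+\frac1{p_1}=\frac1{q_2}+\frac1{p_2}.$$ Let $w_0,w_1,w_2,z_1,z_2$ be weights on $\mathbb R^n$ (measurable functions of $x$, positive almost everywhere) such that $w_0=w_1z_1=w_2z_2$ a.e., $w_j^{q_j}\in A_{q_j}$ for $j=0,1,2$, and, for $j=1,2$, $z_j^{p_j}\in A_{p_j}$ if $p_j<\infty$ and $z_j^{-1}\in A_1$ if $p_j=\infty$. Here $w\in A_1$ means that $\sup_{r>0}r^{-n}\int_{B_r(x)}w\le C\,w(x)$ for a.e. $x$, and $w\in A_p$ ($1<p<\infty$, $p'=p/(p-1)$) means that $\big(\int_Q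 w\big)\big(\int_Q w^{1-p'}\big)^{p-1}\le C|Q|^p$ for all cubes $Q$ with sides parallel to the axes. (a) Let $s_0,\dots,s_4\in[1,\infty]$ with $\frac1{s_0}=\frac1{s_1}+\frac1{s_2}=\frac1{s_3}+\frac1{s_4}$. There is a constant $C<\infty$ such that for every measurable set of times $I\subset\mathbb R$ (for example $I=[0,T)$) and all measurable $u,v:I\times\mathbb R^n\to\mathbb C$ with $\|z_1v\|_{L^{s_2}_tL^{p_1}_x}<\infty$ and $\|z_2u\|_{L^{s_4}_tL^{p_2}_x}<\infty$, $$\|w_0\,2^{js}P_j(uv)\|_{\ell^\lambda_jL^{s_0}_tL^{q_0}_x}\le C\Big(\|w_1\,2^{js}P_ju\|_{\ell^\lambda_jL^{s_1}_tL^{q_1}_x}\|z_1v\|_{L^{s_2}_tL^{p_1}_x}+\|w_2\,2^{js}P_jv\|_{\ell^\lambda_jL^{s_3}_tL^{q_2}_x}\|z_2u\|_{L^{s_4}_tL^{p_2}_x}\Big),$$ all norms being taken over $t\in I$, $x\in\mathbb R^n$, $j\in\mathbb Z$, with values in $[0,\infty]$ and $0\cdot\infty=0$. (b) There is a constant $C<\infty$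 such that for all measurable $u,v:\mathbb R^n\to\mathbb C$ with $\|z_1v\|_{L^{p_1}_x}<\infty$ and $\|z_2u\|_{L^{p_2}_x}<\infty$, $$\|w_0\,2^{js}P_j(uv)\|_{\ell^\lambda_jL^{q_0}_x}\le C\Big(\|w_1\,2^{js}P_ju\|_{\ell^\lambda_jL^{q_1}_x}\|z_1v\|_{L^{p_1}_x}+\|w_2\,2^{js}P_jv\|_{\ell^\lambda_jL^{q_2}_x}\|z_2u\|_{L^{p_2}_x}\Big).$$ In both parts the projections are well defined: $u$ and $v$ (in (a), $u(t,\cdot)$ and $v(t,\cdot)$ for a.e. $t\in I$) are integrable against every Schwartz function, hence tempered distributions, and the same is true of the product $uv$ whenever the right-hand side is finite. -/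

import Mathlib

open MeasureTheory Set
open scoped ENNReal NNReal SchwartzMap FourierTransform

namespace WeightedLeibniz

/-- Euclidean space `ℝⁿ`. -/
abbrev E (n : ℕ) : Type := EuclideanSpace ℝ (Fin n)

/-! ### Weights and Muckenhoupt classes -/

/-- A weight: a measurable function which is positive almost everywhere. -/
structure IsWeight {n : ℕ} (w : E n → ℝ) : Prop where
  aemeasurable : AEMeasurable w volume
  pos : ∀ᵐ x, 0 < w x

/-- The closed cube with sides of length `l` parallel to the axes and lower corner `a`. -/
def cube {n : ℕ} (a : E n) (l : ℝ) : Set (E n) := {x | ∀ i, x i ∈ Icc (a i) (a i + l)}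

/-- The Hardy-Littlewood maximal function `sup_{r > 0} r⁻ⁿ ∫_{B_r(x)} w` of a nonnegative `w`. -/
noncomputable def maximalFunction {n : ℕ} (w : E n → ℝ) (x : E n) : ℝ≥0∞ :=
  ⨆ (r : ℝ) (_ : 0 < r),
    (ENNReal.ofReal (r ^ n))⁻¹ * ∫⁻ y in Metric.ball x r, ENNReal.ofReal (w y)

/-- The class `A₁`: the maximal function of `w` is at most `C w` almost everywhere. -/
def MuckenhouptAOne {n : ℕ} (w : E n → ℝ) : Prop :=
  ∃ C : ℝ≥0, ∀ᵐ x, maximalFunction w x ≤ C * ENNReal.ofReal (w x)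

/-- The class `A_p`, for `1 < p < ∞`; here `1 - p' = 1 - p / (p - 1)`.
The integrals are `[0, ∞]`-valued. -/
def MuckenhouptA {n : ℕ} (p : ℝ) (w : E n → ℝ) : Prop :=
  ∃ C : ℝ≥0, ∀ (a : E n) (l : ℝ), 0 < l →
    (∫⁻ x in cube a l, ENNReal.ofReal (w x)) *
        (∫⁻ x in cube a l, ENNReal.ofReal (w x ^ (1 - p / (p - 1)))) ^ (p - 1)
      ≤ C * volume (cube a l) ^ p

/-- The condition on the weights `z` that multiply the undifferentiated factors:
`z ^ p ∈ A_p` when `p < ∞`, and `z⁻¹ ∈ A₁` when `p = ∞`. -/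
def AdmissibleFactorWeight {n : ℕ} (p : ℝ≥0∞) (z : E n → ℝ) : Prop :=
  (p < ∞ → MuckenhouptA p.toReal (fun x => z x ^ p.toReal)) ∧
  (p = ∞ → MuckenhouptAOne (fun x => (z x)⁻¹))

/-! ### Littlewood-Paley projections -/

/-- `φ` generates a homogeneous (smooth, dyadic) Littlewood-Paley partition of unity on
`(0, ∞)`. -/
structure IsLittlewoodPaley (φ : ℝ → ℝ) : Prop where
  smooth : ContDiff ℝ ((⊤ : ℕ∞) : WithTop ℕ∞) φ
  compact : HasCompactSupport φ
  support_pos : tsupport φ ⊆ Ioi 0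
  sum_eq_one : ∀ r : ℝ, 0 < r → HasSum (fun j : ℤ => φ ((2 : ℝ) ^ (-j) * r)) 1

/-- The convolution kernel of `φ(2⁻ʲ D)`, `D = √(-Δ)`: the inverse Fourier transform of its symbol.
In Mathlib's normalization `e^{-2πi⟨x, ξ⟩}` of the Fourier transform, `D` has symbol `2π|ξ|`. -/
noncomputable def lpKernel {n : ℕ} (φ : ℝ → ℝ) (j : ℤ) : E n → ℂ :=
  𝓕⁻ (fun ξ : E n => ((φ ((2 : ℝ) ^ (-j) * (2 * Real.pi * ‖ξ‖)) : ℝ) : ℂ))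

/-- The Littlewood-Paley projection `P_j f = φ(2⁻ʲ D) f`, for functions `f` which are tempered
distributions: the convolution of `f` with the (Schwartz) kernel of `φ(2⁻ʲ D)`. -/
noncomputable def lpProj {n : ℕ} (φ : ℝ → ℝ) (j : ℤ) (f : E n → ℂ) (x : E n) : ℂ :=
  ∫ y, lpKernel φ j (x - y) * f y

/-- `f` is a function which is a tempered distribution, by (absolutely convergent) integration
against Schwartz functions. For such `f` all integrals in the definition of `P_j f` converge. -/
def IsTempered {n : ℕ} (f : E n → ℂ) : Prop :=
  ∀ ψ : 𝓢(E n, ℂ), Integrable (fun x => ψ x * f x)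

/-! ### Norms

All norms take values in `[0, ∞]`. -/

/-- The weighted Lebesgue norm `‖w f‖_{L^q_x}`. -/
noncomputable def wNorm {n : ℕ} (q : ℝ≥0∞) (w : E n → ℝ) (f : E n → ℂ) : ℝ≥0∞ :=
  eLpNorm (fun x => (w x : ℂ) * f x) q volume

/-- The weighted mixed norm `‖w u‖_{L^a_t L^q_x}` on `I × ℝⁿ`. -/
noncomputable def wMixedNorm {n : ℕ} (I : Set ℝ) (a q : ℝ≥0∞) (w : E n → ℝ)
    (u : ℝ → E n → ℂ) : ℝ≥0∞ :=
  eLpNorm (fun t => wNorm q w (u t)) a (volume.restrict I)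

/-- The weighted Besov norm `‖w 2^{js} P_j f‖_{ℓ^lam_j L^q_x}`. -/
noncomputable def wBesov {n : ℕ} (φ : ℝ → ℝ) (s : ℝ) (lam q : ℝ≥0∞) (w : E n → ℝ)
    (f : E n → ℂ) : ℝ≥0∞ :=
  eLpNorm (fun j : ℤ => wNorm q w (fun x => (((2 : ℝ) ^ ((j : ℝ) * s) : ℝ) : ℂ) * lpProj φ j f x))
    lam Measure.count

/-- The weighted space-time Besov norm `‖w 2^{js} P_j u‖_{ℓ^lam_j L^a_t L^q_x}` on `I × ℝⁿ`, where
`P_j` acts on the space variable. -/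
noncomputable def wMixedBesov {n : ℕ} (φ : ℝ → ℝ) (I : Set ℝ) (s : ℝ) (lam a q : ℝ≥0∞)
    (w : E n → ℝ) (u : ℝ → E n → ℂ) : ℝ≥0∞ :=
  eLpNorm (fun j : ℤ => wMixedNorm I a q w
    (fun t x => (((2 : ℝ) ^ ((j : ℝ) * s) : ℝ) : ℂ) * lpProj φ j (u t) x)) lam Measure.count

end WeightedLeibniz

/-! The proof is a paraproduct decomposition in which every estimate is reduced to averaging
operators. Let `S_k` be the smooth cut-off to frequencies at most about `2^k`, so that `S_k -
S_{k-1} = P_k`. If `N` is large, depending only on the support of `φ`, then `S_{j-N}u · S_{j-N}v`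
has frequencies below the annulus seen by `P_j`, so `P_j(uv) = P_j(uv - S_{j-N}u S_{j-N}v)`.
Telescoping with `S_{k+1}u S_{k+1}v - S_k u S_k v = P_{k+1}u S_{k+1}v + S_k u P_{k+1}v` bounds the
remainder by a sum over `k ≥ j-N` in which one factor is a dyadic piece and the other a
low-frequency cut-off (`enorm_mul_sub_le_paraproductMajorant`). Only the limit `k → ∞` is taken, at
Lebesgue points, so no convergence at low frequency is required.

The kernels of `P_k` and `S_k` are bounded by `L¹`-normalised kernels with power decay, and these by
sums of normalised indicators of balls. Averages over balls of one fixed radius are bounded on a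
weighted `L^p`, uniformly in the radius, directly from the `A_p` inequality on cubes, and on
weighted `L^∞` from `A_1` (`ballBound_of_cubes`, `IsWeight.decayBound_of_muckenhouptAOne`). No
maximal theorem or singular integral is involved. Hence the outer `P_j` is bounded with weight `w₀`,
the factors `S_k u` and `S_k v` with weights `z₂` and `z₁`, and Hölder's inequality with `w₀ = w₁z₁
= w₂z₂` gives a dyadic estimate (`lpProj_mul_bound`).

After multiplication by `2^{js}` the term at frequency `k` carries `2^{-(k-j)s}`. As `s > 0`, this
is convolution on `ℤ` with a summable sequence, which is bounded on `ℓ^λ`. For space-time functions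
the dyadic estimate holds at almost every time, and Minkowski's and Hölder's inequalities in time
are applied before the sum over `j`.

The same weighted bounds show that `u` and `v` are integrable against `(1+|x|)^{-(n+1)}`
(`DecayBound.decayMass_lt_top`). This makes them tempered and justifies each use of Fubini's
theorem. -/

namespace WeightedLeibniz

/-! ### Lebesgue norms of `[0, ∞]`-valued functions -/

section ENNRealNorms

variable {α : Type*} {mα : MeasurableSpace α} {μ : Measure α}

theorem eLpNorm_mono_ennreal {p : ℝ≥0∞} {f g : α → ℝ≥0∞} (h : ∀ᵐ x ∂μ, f x ≤ g x) :
    eLpNorm f p μ ≤ eLpNorm g p μ :=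
  eLpNorm_mono_enorm_ae (by simpa using h)

theorem eLpNorm_nnreal_mul_le {p : ℝ≥0∞} {f g : α → ℝ≥0∞} {C : ℝ≥0}
    (h : ∀ᵐ x ∂μ, f x ≤ C * g x) : eLpNorm f p μ ≤ C * eLpNorm g p μ := by
  have := eLpNorm_le_nnreal_smul_eLpNorm_of_ae_le_mul' (μ := μ) (f := f) (g := g) (c := C)
    (by simpa using h) p
  simpa [ENNReal.smul_def] using this

theorem eLpNorm_const_mul_le {p : ℝ≥0∞} {f : α → ℝ≥0∞} {c : ℝ≥0∞} (hc : c ≠ ∞) :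
    eLpNorm (fun x => c * f x) p μ ≤ c * eLpNorm f p μ := by
  lift c to ℝ≥0 using hc
  exact eLpNorm_nnreal_mul_le (ae_of_all _ fun _ => le_rfl)

theorem eLpNorm_add_le_ennreal {p : ℝ≥0∞} (hp : 1 ≤ p) {f g : α → ℝ≥0∞}
    (hf : AEMeasurable f μ) (hg : AEMeasurable g μ) :
    eLpNorm (fun x => f x + g x) p μ ≤ eLpNorm f p μ + eLpNorm g p μ :=
  eLpNorm_add_le hf.aestronglyMeasurable hg.aestronglyMeasurable hp

/-- Monotone convergence for Lebesgue norms, in the form of an upper bound. -/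
theorem eLpNorm_iSup_nat_le {p : ℝ≥0∞} {f : ℕ → α → ℝ≥0∞}
    (hf : ∀ m, AEMeasurable (f m) μ) (hmono : ∀ x, Monotone fun m => f m x) :
    eLpNorm (fun x => ⨆ m, f m x) p μ ≤ ⨆ m, eLpNorm (f m) p μ := by
  rcases eq_or_ne p 0 with rfl | hp0
  · simp
  rcases eq_or_ne p ∞ with rfl | hp
  · simp only [eLpNorm_exponent_top]
    refine essSup_le_of_ae_le _ ?_
    have h : ∀ᵐ x ∂μ, ∀ m, f m x ≤ eLpNormEssSup (f m) μ :=
      ae_all_iff.2 fun m => by simpa using ae_le_eLpNormEssSup (f := f m) (μ := μ)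
    filter_upwards [h] with x hx
    simpa using iSup_mono hx
  · have hp' : 0 < p.toReal := ENNReal.toReal_pos hp0 hp
    simp only [eLpNorm_eq_lintegral_rpow_enorm_toReal hp0 hp, enorm_eq_self]
    have h1 : ∀ x, (⨆ m, f m x) ^ p.toReal = ⨆ m, f m x ^ p.toReal := fun x =>
      (ENNReal.orderIsoRpow p.toReal hp').map_iSup _
    have h2 : ∫⁻ x, ⨆ m, f m x ^ p.toReal ∂μ = ⨆ m, ∫⁻ x, f m x ^ p.toReal ∂μ :=
      lintegral_iSup' (fun m => (hf m).pow_const _)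
        (ae_of_all _ fun x m m' hmm => ENNReal.rpow_le_rpow (hmono x hmm) hp'.le)
    have h3 : ∀ a : ℕ → ℝ≥0∞, (⨆ m, a m) ^ (1 / p.toReal) = ⨆ m, a m ^ (1 / p.toReal) :=
      fun a => (ENNReal.orderIsoRpow (1 / p.toReal) (by positivity)).map_iSup _
    simp only [h1, h2, h3, le_refl]

/-- Minkowski's inequality for countable sums. -/
theorem eLpNorm_tsum_le {p : ℝ≥0∞} (hp : 1 ≤ p) {f : ℕ → α → ℝ≥0∞}
    (hf : ∀ m, AEMeasurable (f m) μ) :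
    eLpNorm (fun x => ∑' m, f m x) p μ ≤ ∑' m, eLpNorm (f m) p μ := by
  have h := eLpNorm_iSup_nat_le (p := p) (μ := μ)
    (f := fun N x => ∑ m ∈ Finset.range N, f m x)
    (fun N => Finset.aemeasurable_fun_sum _ fun m _ => hf m)
    (fun x N N' hN => Finset.sum_le_sum_of_subset (Finset.range_mono hN))
  simp only [ENNReal.tsum_eq_iSup_nat] at h ⊢
  refine h.trans (iSup_mono fun N => ?_)
  have := eLpNorm_sum_le (μ := μ) (p := p) (f := f) (s := Finset.range N)
    (fun m _ => (hf m).aestronglyMeasurable) hp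
  rwa [Finset.sum_fn] at this

theorem eLpNorm_eq_zero_iff_ennreal {p : ℝ≥0∞} (hp : p ≠ 0) {f : α → ℝ≥0∞}
    (hf : AEMeasurable f μ) : eLpNorm f p μ = 0 ↔ f =ᵐ[μ] 0 :=
  eLpNorm_eq_zero_iff hf.aestronglyMeasurable hp

/-- The delicate case is an infinite norm of `g`, because of `0 · ∞ = 0`: if the norm of `f`
vanishes, then `f = 0` almost everywhere (this uses measurability) and so does the product. -/
theorem eLpNorm_mul_top_le {p : ℝ≥0∞} {f g : α → ℝ≥0∞} (hf : AEMeasurable f μ) :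
    eLpNorm (fun x => f x * g x) p μ ≤ eLpNorm f p μ * eLpNorm g ∞ μ := by
  have hg : ∀ᵐ x ∂μ, g x ≤ eLpNorm g ∞ μ := by
    simpa using ae_le_eLpNormEssSup (f := g) (μ := μ)
  rcases eq_or_ne p 0 with rfl | hp0
  · simp
  rcases eq_or_ne (eLpNorm g ∞ μ) ∞ with htop | htop
  · rcases eq_or_ne (eLpNorm f p μ) 0 with h0 | h0
    · rw [eLpNorm_eq_zero_iff_ennreal hp0 hf] at h0
      have : (fun x => f x * g x) =ᵐ[μ] 0 := by
        filter_upwards [h0] with x hx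
        simp [hx]
      rw [eLpNorm_congr_ae this]
      simp
    · rw [htop, ENNReal.mul_top h0]
      exact le_top
  · rw [mul_comm]
    refine le_trans (eLpNorm_mono_ennreal ?_) (eLpNorm_const_mul_le htop)
    filter_upwards [hg] with x hx
    rw [mul_comm]
    gcongr

/-- Hölder's inequality. -/
theorem eLpNorm_mul_le {r p q : ℝ≥0∞} (h : r⁻¹ = p⁻¹ + q⁻¹) (hr : r ≠ 0) {f g : α → ℝ≥0∞}
    (hf : AEMeasurable f μ) (hg : AEMeasurable g μ) :
    eLpNorm (fun x => f x * g x) r μ ≤ eLpNorm f p μ * eLpNorm g q μ := by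
  -- Infinite exponents are settled first. Afterwards `r ≠ 0` forces `p, q ≠ 0`, and all exponents
  -- are positive reals with `r < p`.
  rcases eq_or_ne q ∞ with rfl | hq
  · obtain rfl : r = p := by simpa using h
    exact eLpNorm_mul_top_le hf
  rcases eq_or_ne p ∞ with rfl | hp
  · obtain rfl : r = q := by simpa using h
    simp only [mul_comm (f _), mul_comm (eLpNorm f ∞ μ)]
    exact eLpNorm_mul_top_le hg
  have hr' : r⁻¹ ≠ ∞ := by simpa using hr
  have hp0 : p ≠ 0 := by
    rintro rfl
    simp [h] at hr'
  have hq0 : q ≠ 0 := by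
    rintro rfl
    simp [h] at hr'
  have hrt : r ≠ ∞ := by
    rintro rfl
    have h' := h.symm
    simp [hp] at h'
  have hreal : 1 / r.toReal = 1 / p.toReal + 1 / q.toReal := by
    have := congrArg ENNReal.toReal h
    rw [ENNReal.toReal_add (by simpa using hp0) (by simpa using hq0)] at this
    simpa using this
  have hrpos : 0 < r.toReal := ENNReal.toReal_pos hr hrt
  have hppos : 0 < p.toReal := ENNReal.toReal_pos hp0 hp
  have hqpos : 0 < q.toReal := ENNReal.toReal_pos hq0 hq
  have hrp : r.toReal < p.toReal := by
    have : 1 / p.toReal < 1 / r.toReal := by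
      rw [hreal]
      have : 0 < 1 / q.toReal := by positivity
      linarith
    exact (one_div_lt_one_div hppos hrpos).1 this
  have := ENNReal.lintegral_Lp_mul_le_Lq_mul_Lr hrpos hrp hreal μ hf hg
  simpa [eLpNorm_eq_lintegral_rpow_enorm_toReal, hr, hrt, hp0, hp, hq0, hq] using this

theorem ae_lt_top_of_eLpNorm_lt_top {p : ℝ≥0∞} (hp : p ≠ 0) {f : α → ℝ≥0∞}
    (hf : AEMeasurable f μ) (h : eLpNorm f p μ < ∞) : ∀ᵐ x ∂μ, f x < ∞ := by
  rcases eq_or_ne p ∞ with rfl | hp'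
  · have : ∀ᵐ x ∂μ, f x ≤ eLpNormEssSup f μ := by
      simpa using ae_le_eLpNormEssSup (f := f) (μ := μ)
    filter_upwards [this] with x hx using hx.trans_lt (by simpa using h)
  · have hpos : 0 < p.toReal := ENNReal.toReal_pos hp hp'
    rw [eLpNorm_eq_lintegral_rpow_enorm_toReal hp hp', ENNReal.rpow_lt_top_iff_of_pos
      (by positivity)] at h
    filter_upwards [ae_lt_top' (hf.enorm.pow_const _) h.ne] with x hx
    simpa [ENNReal.rpow_lt_top_iff_of_pos hpos] using hx

end ENNRealNorms


variable {n : ℕ}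

/-! ### Averages over balls and against power-decay kernels -/

/-- The `L¹`-normalised kernel at scale `t⁻¹` with decay of order `n + i`. -/
noncomputable def decay (i : ℕ) (t : ℝ) (x : E n) : ℝ≥0∞ :=
  ENNReal.ofReal (t ^ n / (1 + t * ‖x‖) ^ (n + i))

/-- The convolution of `f` with `decay i t`. -/
noncomputable def decayAvg (i : ℕ) (t : ℝ) (f : E n → ℝ≥0∞) (x : E n) : ℝ≥0∞ :=
  ∫⁻ y, decay i t (x - y) * f y

/-- The average of `f` over the ball `B_r(x)`, up to a dimensional constant. -/
noncomputable def ballAvg (r : ℝ) (f : E n → ℝ≥0∞) (x : E n) : ℝ≥0∞ :=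
  (ENNReal.ofReal (r ^ n))⁻¹ * ∫⁻ y in Metric.ball x r, f y

theorem measurable_decay (i : ℕ) (t : ℝ) : Measurable (decay (n := n) i t) := by
  unfold decay
  fun_prop

theorem measurable_decayAvg (i : ℕ) (t : ℝ) {f : E n → ℝ≥0∞} (hf : AEMeasurable f volume) :
    Measurable (decayAvg i t f) := by
  have : decayAvg i t f = decayAvg i t (hf.mk f) := by
    ext x
    refine lintegral_congr_ae ?_
    filter_upwards [hf.ae_eq_mk] with y hy
    rw [hy]
  rw [this]
  refine Measurable.lintegral_prod_right (f := fun x y => decay i t (x - y) * hf.mk f y) ?_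
  exact ((measurable_decay i t).comp (measurable_fst.sub measurable_snd)).mul
    (hf.measurable_mk.comp measurable_snd)

theorem setLIntegral_ball_eq (r : ℝ) (f : E n → ℝ≥0∞) (x : E n) :
    ∫⁻ y in Metric.ball x r, f y = ∫⁻ y, {z : E n × E n | dist z.2 z.1 < r}.indicator
      (fun z => f z.2) (x, y) := by
  rw [← lintegral_indicator measurableSet_ball]
  rfl

theorem measurable_setLIntegral_ball (r : ℝ) {f : E n → ℝ≥0∞} (hf : AEMeasurable f volume) :
    Measurable (fun x : E n => ∫⁻ y in Metric.ball x r, f y) := by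
  have : (fun x : E n => ∫⁻ y in Metric.ball x r, f y)
      = fun x : E n => ∫⁻ y in Metric.ball x r, hf.mk f y := by
    ext x
    exact lintegral_congr_ae (ae_restrict_of_ae hf.ae_eq_mk)
  rw [this]
  simp only [setLIntegral_ball_eq]
  refine Measurable.lintegral_prod_right ?_
  exact (hf.measurable_mk.comp measurable_snd).indicator
    (measurableSet_lt (by fun_prop) measurable_const)

theorem measurable_ballAvg (r : ℝ) {f : E n → ℝ≥0∞} (hf : AEMeasurable f volume) :
    Measurable (ballAvg r f) :=
  (measurable_setLIntegral_ball r hf).const_mul _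

/-- The kernel `decay i t` is dominated by a superposition of normalised indicators of balls. -/
theorem decay_le_tsum (i : ℕ) {t : ℝ} (ht : 0 < t) (x y : E n) :
    decay i t (x - y) ≤ 2 ^ (n + i) * ∑' m : ℕ, (2⁻¹ : ℝ≥0∞) ^ (i * m) *
      ((ENNReal.ofReal ((2 ^ m / t) ^ n))⁻¹ *
        (Metric.ball x (2 ^ m / t)).indicator (fun _ => 1) y) := by
  have hz : 0 ≤ t * ‖x - y‖ := by positivity
  have hex : ∃ m : ℕ, t * ‖x - y‖ < 2 ^ m := pow_unbounded_of_one_lt _ one_lt_two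
  classical
  -- The least `m` for which the ball of radius `2^m / t` contains `y`. Minimality gives `2^m ≤ 2 (1
  -- + t|x - y|)`, so this single term of the series already dominates the kernel, at the cost of
  -- `2^{n+i}`.
  let m := Nat.find hex
  have hm : t * ‖x - y‖ < 2 ^ m := Nat.find_spec hex
  have hm' : (2 : ℝ) ^ m ≤ 2 * (1 + t * ‖x - y‖) := by
    rcases Nat.eq_zero_or_pos m with h0 | h0
    · rw [h0]
      linarith [hz, pow_zero (2 : ℝ)]
    · obtain ⟨k, hk⟩ := Nat.exists_eq_succ_of_ne_zero h0.ne'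
      have := Nat.find_min hex (m := k) (by change k < m; omega)
      rw [hk, pow_succ]
      linarith
  have hmem : y ∈ Metric.ball x (2 ^ m / t) := by
    rw [Metric.mem_ball', dist_eq_norm, lt_div_iff₀ ht]
    linarith
  refine le_trans ?_ (mul_le_mul_right (ENNReal.le_tsum m) _)
  rw [indicator_of_mem hmem, mul_one, ← ENNReal.ofReal_inv_of_pos (by positivity)]
  have h2 : (2⁻¹ : ℝ≥0∞) ^ (i * m) = ENNReal.ofReal ((2⁻¹ : ℝ) ^ (i * m)) := by
    rw [ENNReal.ofReal_pow (by positivity), ENNReal.ofReal_inv_of_pos (by positivity)]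
    simp
  have h3 : (2 : ℝ≥0∞) ^ (n + i) = ENNReal.ofReal ((2 : ℝ) ^ (n + i)) := by
    rw [ENNReal.ofReal_pow (by positivity)]
    simp
  rw [h2, h3, ← ENNReal.ofReal_mul (by positivity), ← ENNReal.ofReal_mul (by positivity), decay]
  refine ENNReal.ofReal_le_ofReal ?_
  have h4 : ((2 : ℝ) ^ m) ^ (n + i) ≤ (2 * (1 + t * ‖x - y‖)) ^ (n + i) := by gcongr
  have h5 : (2 : ℝ) ^ (n + i) * ((2⁻¹ : ℝ) ^ (i * m) * ((2 ^ m / t) ^ n)⁻¹)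
      = t ^ n * 2 ^ (n + i) / ((2 : ℝ) ^ m) ^ (n + i) := by
    rw [inv_pow, mul_comm i m, pow_mul, pow_add ((2 : ℝ) ^ m), div_pow]
    field_simp
  rw [h5, div_le_div_iff₀ (by positivity) (by positivity)]
  rw [mul_pow] at h4
  calc _ ≤ t ^ n * (2 ^ (n + i) * (1 + t * ‖x - y‖) ^ (n + i)) := by gcongr
    _ = _ := by ring

theorem decayAvg_le_tsum (i : ℕ) {t : ℝ} (ht : 0 < t) {f : E n → ℝ≥0∞}
    (hf : AEMeasurable f volume) (x : E n) :
    decayAvg i t f x ≤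
      2 ^ (n + i) * ∑' m : ℕ, (2⁻¹ : ℝ≥0∞) ^ (i * m) * ballAvg (2 ^ m / t) f x := by
  have h1 : ∀ m : ℕ, ballAvg (2 ^ m / t) f x = ∫⁻ y, (ENNReal.ofReal ((2 ^ m / t) ^ n))⁻¹ *
      (Metric.ball x (2 ^ m / t)).indicator (fun _ => 1) y * f y := fun m => by
    rw [ballAvg, ← lintegral_indicator measurableSet_ball,
      ← lintegral_const_mul'' _ (hf.indicator measurableSet_ball)]
    refine lintegral_congr fun y => ?_
    by_cases hy : y ∈ Metric.ball x (2 ^ m / t) <;> simp [hy]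
  have hm : ∀ m : ℕ, AEMeasurable (fun y => (ENNReal.ofReal ((2 ^ m / t) ^ n))⁻¹ *
      (Metric.ball x (2 ^ m / t)).indicator (fun _ => 1) y * f y) volume := fun m =>
    ((measurable_const.indicator measurableSet_ball).const_mul _).aemeasurable.mul hf
  calc decayAvg i t f x
      ≤ ∫⁻ y, 2 ^ (n + i) * ∑' m : ℕ, (2⁻¹ : ℝ≥0∞) ^ (i * m) *
        ((ENNReal.ofReal ((2 ^ m / t) ^ n))⁻¹ *
          (Metric.ball x (2 ^ m / t)).indicator (fun _ => 1) y * f y) := by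
        refine lintegral_mono fun y => ?_
        refine (mul_le_mul_left (decay_le_tsum i ht x y) _).trans_eq ?_
        rw [mul_assoc, ← ENNReal.tsum_mul_right]
        simp only [mul_assoc]
    _ = _ := by
        rw [lintegral_const_mul' _ _ (by simp), lintegral_tsum fun m => (hm m).const_mul _]
        congr 2
        ext m
        rw [lintegral_const_mul'' _ (hm m), h1]

theorem tsum_two_inv_pow : ∑' m : ℕ, (2⁻¹ : ℝ≥0∞) ^ m = 2 := by
  rw [ENNReal.tsum_geometric, ENNReal.one_sub_inv_two, inv_inv]

/-! ### Boundedness of averages on weighted Lebesgue spaces -/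

/-- Averages over balls of every radius are bounded on `L^p` with multiplicative weight `W`. -/
def BallBound (p : ℝ≥0∞) (W : E n → ℝ≥0∞) : Prop :=
  ∃ C : ℝ≥0, ∀ r : ℝ, 0 < r → ∀ f : E n → ℝ≥0∞, AEMeasurable f volume →
    eLpNorm (fun x => W x * ballAvg r f x) p volume ≤
      C * eLpNorm (fun x => W x * f x) p volume

/-- Convolutions with `decay 1 t` are bounded on `L^p` with multiplicative weight `W`, uniformly
in `t`. -/
def DecayBound (p : ℝ≥0∞) (W : E n → ℝ≥0∞) : Prop :=
  ∃ C : ℝ≥0, ∀ t : ℝ, 0 < t → ∀ f : E n → ℝ≥0∞, AEMeasurable f volume →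
    eLpNorm (fun x => W x * decayAvg 1 t f x) p volume ≤
      C * eLpNorm (fun x => W x * f x) p volume

/-- Minkowski's inequality applied to the ball decomposition. One order of decay beyond `n` gives
the summable weights `2^{-m}`, and uniformity in the radius becomes uniformity in `t`. -/
theorem BallBound.decayBound {p : ℝ≥0∞} (hp : 1 ≤ p) {W : E n → ℝ≥0∞}
    (hW : AEMeasurable W volume) (h : BallBound p W) : DecayBound p W := by
  obtain ⟨C, hC⟩ := h
  refine ⟨2 ^ (n + 1) * (2 * C), fun t ht f hf => ?_⟩
  have hm : ∀ m : ℕ, AEMeasurable (fun x => (2⁻¹ : ℝ≥0∞) ^ m *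
      (W x * ballAvg (2 ^ m / t) f x)) volume := fun m =>
    (hW.mul (measurable_ballAvg _ hf).aemeasurable).const_mul _
  calc eLpNorm (fun x => W x * decayAvg 1 t f x) p volume
      ≤ eLpNorm (fun x => 2 ^ (n + 1) * ∑' m : ℕ, (2⁻¹ : ℝ≥0∞) ^ m *
        (W x * ballAvg (2 ^ m / t) f x)) p volume := by
        refine eLpNorm_mono_ennreal (ae_of_all _ fun x => ?_)
        refine (mul_le_mul_right (decayAvg_le_tsum 1 ht hf x) _).trans_eq ?_
        simp only [one_mul, mul_left_comm (W x), ← ENNReal.tsum_mul_left]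
    _ ≤ 2 ^ (n + 1) * ∑' m : ℕ, eLpNorm (fun x => (2⁻¹ : ℝ≥0∞) ^ m *
        (W x * ballAvg (2 ^ m / t) f x)) p volume :=
        (eLpNorm_const_mul_le (by simp)).trans (mul_le_mul_right (eLpNorm_tsum_le hp hm) _)
    _ ≤ 2 ^ (n + 1) * ∑' m : ℕ, (2⁻¹ : ℝ≥0∞) ^ m *
        (C * eLpNorm (fun x => W x * f x) p volume) := by
        gcongr with m
        refine (eLpNorm_const_mul_le (by simp)).trans ?_
        gcongr
        exact hC _ (by positivity) f hf
    _ = _ := by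
        rw [ENNReal.tsum_mul_right, tsum_two_inv_pow]
        push_cast
        ring

/-- The closed cube centred at `c` with half side `r`. -/
def box (c : E n) (r : ℝ) : Set (E n) := {x | ∀ i, |x i - c i| ≤ r}

theorem mem_box_comm {c x : E n} {r : ℝ} : x ∈ box c r ↔ c ∈ box x r := by
  simp only [box, mem_ofPred_eq, abs_sub_comm]

theorem box_eq_cube (c : E n) (r : ℝ) :
    box c r = cube (WithLp.toLp 2 fun i => c i - r) (2 * r) := by
  ext x
  simp only [box, cube, mem_ofPred_eq, mem_Icc, abs_le]
  refine forall_congr' fun i => ⟨fun h => ⟨?_, ?_⟩, fun h => ⟨?_, ?_⟩⟩ <;> linarith [h.1, h.2]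

theorem ball_subset_box (c : E n) (r : ℝ) : Metric.ball c r ⊆ box c r := fun x hx i => by
  have h1 : ‖(x - c) i‖ ≤ ‖x - c‖ := PiLp.norm_apply_le _ _
  rw [Metric.mem_ball, dist_eq_norm] at hx
  exact (show |x i - c i| ≤ ‖x - c‖ from h1).trans hx.le

theorem volume_cube (a : E n) (l : ℝ) : volume (cube a l) = ENNReal.ofReal l ^ n := by
  have h1 : cube a l = (MeasurableEquiv.toLp 2 (Fin n → ℝ)).symm ⁻¹'
      (Set.pi univ fun i => Icc (a i) (a i + l)) := by
    ext x
    simp only [cube, mem_ofPred_eq, mem_preimage, mem_pi, mem_univ, true_imp_iff]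
    rfl
  rw [h1, (EuclideanSpace.volume_preserving_symm_measurableEquiv_toLp (Fin n)).measure_preimage
    (MeasurableSet.univ_pi fun i => measurableSet_Icc).nullMeasurableSet, volume_pi_pi]
  simp

theorem measurableSet_box_prod (r : ℝ) :
    MeasurableSet {z : E n × E n | z.2 ∈ box z.1 r} := by
  have : {z : E n × E n | z.2 ∈ box z.1 r} = ⋂ i, {z | |z.2 i - z.1 i| ≤ r} := by
    ext z
    simp [box]
  rw [this]
  exact MeasurableSet.iInter fun i => measurableSet_le (by fun_prop) measurable_const

theorem measurableSet_box (c : E n) (r : ℝ) : MeasurableSet (box c r) :=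
  measurable_prodMk_left (measurableSet_box_prod r)

/-- The defining inequality of `A_p` bounds averages over cubes, by Hölder's inequality. -/
theorem lintegral_weight_mul_lintegral_rpow_le {p : ℝ} (hp : 1 < p) {W : E n → ℝ≥0∞}
    (hW : AEMeasurable W volume) (hW0 : ∀ᵐ x, W x ≠ 0 ∧ W x ≠ ∞) {C : ℝ≥0∞} {Q : Set (E n)}
    (hQ : (∫⁻ x in Q, W x ^ p) * (∫⁻ x in Q, W x ^ (-(p / (p - 1)))) ^ (p - 1) ≤ C)
    {f : E n → ℝ≥0∞} (hf : AEMeasurable f volume) :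
    (∫⁻ x in Q, W x ^ p) * (∫⁻ x in Q, f x) ^ p ≤ C * ∫⁻ x in Q, (W x * f x) ^ p := by
  have hp1 : 0 < p - 1 := by linarith
  have hp0 : 0 < p := by linarith
  have hconj : p.HolderConjugate (p / (p - 1)) := Real.HolderConjugate.conjExponent hp
  have h1 : ∫⁻ x in Q, f x = ∫⁻ x in Q, ((fun x => W x * f x) * fun x => (W x)⁻¹) x := by
    refine lintegral_congr_ae (ae_restrict_of_ae ?_)
    filter_upwards [hW0] with x hx
    simp only [Pi.mul_apply]
    rw [mul_right_comm, ENNReal.mul_inv_cancel hx.1 hx.2, one_mul]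
  have h2 := ENNReal.lintegral_mul_le_Lp_mul_Lq (volume.restrict Q) hconj
    (f := fun x => W x * f x) (g := fun x => (W x)⁻¹) (hW.mul hf).restrict hW.inv.restrict
  rw [← h1] at h2
  have h3 : (∫⁻ x in Q, f x) ^ p ≤
      (∫⁻ x in Q, (W x * f x) ^ p) * (∫⁻ x in Q, W x ^ (-(p / (p - 1)))) ^ (p - 1) := by
    refine (ENNReal.rpow_le_rpow h2 hp0.le).trans_eq ?_
    rw [ENNReal.mul_rpow_of_nonneg _ _ hp0.le, ← ENNReal.rpow_mul, ← ENNReal.rpow_mul]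
    have e1 : 1 / p * p = 1 := by field_simp
    have e2 : 1 / (p / (p - 1)) * p = p - 1 := by field_simp
    rw [e1, e2, ENNReal.rpow_one]
    simp only [ENNReal.inv_rpow, ENNReal.rpow_neg]
  calc _ ≤ (∫⁻ x in Q, W x ^ p) * ((∫⁻ x in Q, (W x * f x) ^ p) *
        (∫⁻ x in Q, W x ^ (-(p / (p - 1)))) ^ (p - 1)) := by gcongr
    _ = ((∫⁻ x in Q, W x ^ p) * (∫⁻ x in Q, W x ^ (-(p / (p - 1)))) ^ (p - 1)) *
        ∫⁻ x in Q, (W x * f x) ^ p := by ring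
    _ ≤ _ := by gcongr


/-- By Tonelli: the centres of the boxes that contain a given `y` form a box of side `2r` about `y`.
-/
theorem lintegral_lintegral_box (r : ℝ) {h : E n → ℝ≥0∞} (hh : AEMeasurable h volume) :
    ∫⁻ c, ∫⁻ y in box c r, h y = ENNReal.ofReal (2 * r) ^ n * ∫⁻ y, h y := by
  have e1 : ∀ c : E n, ∫⁻ y in box c r, h y
      = ∫⁻ y, {z : E n × E n | z.2 ∈ box z.1 r}.indicator (fun z => h z.2) (c, y) := fun c => by
    rw [← lintegral_indicator (measurableSet_box c r)]
    rfl
  simp only [e1]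
  rw [lintegral_lintegral_swap]
  · have e2 : ∀ y : E n, ∫⁻ c, {z : E n × E n | z.2 ∈ box z.1 r}.indicator (fun z => h z.2) (c, y)
        = ENNReal.ofReal (2 * r) ^ n * h y := fun y => by
      have : ∀ c : E n, {z : E n × E n | z.2 ∈ box z.1 r}.indicator (fun z => h z.2) (c, y)
          = (box y r).indicator (fun _ => h y) c := fun c => by
        by_cases hc : c ∈ box y r
        · rw [indicator_of_mem hc, indicator_of_mem]
          exact mem_box_comm.1 hc
        · rw [indicator_of_notMem hc, indicator_of_notMem]
          exact fun h => hc (mem_box_comm.1 h)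
      simp only [this]
      rw [lintegral_indicator (measurableSet_box y r), setLIntegral_const, box_eq_cube,
        volume_cube, mul_comm]
    simp only [e2]
    rw [lintegral_const_mul'' _ hh]
  · exact (hh.comp_quasiMeasurePreserving Measure.quasiMeasurePreserving_snd).indicator
      (measurableSet_box_prod r)

/-- For a fixed radius no covering argument is needed. Average over auxiliary centres `c`: if `|x -
c| < r`, then `B_r(x)` lies in the cube about `c` with half side `2r`, on which the `A_p` inequality
applies. Integrating over `c` counts each point with the volume of a ball on the left and of a cube
on the right. -/
theorem ballBound_of_cubes {p : ℝ} (hp : 1 < p) {W : E n → ℝ≥0∞}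
    (hW : AEMeasurable W volume) (hW0 : ∀ᵐ x, W x ≠ 0 ∧ W x ≠ ∞) {C : ℝ≥0}
    (hA : ∀ (a : E n) (l : ℝ), 0 < l → (∫⁻ x in cube a l, W x ^ p) *
      (∫⁻ x in cube a l, W x ^ (-(p / (p - 1)))) ^ (p - 1) ≤ C * volume (cube a l) ^ p) :
    BallBound (ENNReal.ofReal p) W := by
  have hp0 : 0 < p := by linarith
  set V : ℝ≥0∞ := volume (Metric.ball (0 : E n) 1) with hV
  have hV0 : V ≠ 0 := (Metric.measure_ball_pos volume _ one_pos).ne'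
  have hVt : V ≠ ∞ := measure_ball_lt_top.ne
  have hball : ∀ (c : E n) {r : ℝ}, 0 < r →
      volume (Metric.ball c r) = ENNReal.ofReal r ^ n * V := fun c r hr => by
    rw [Measure.addHaar_ball_of_pos volume c hr, ENNReal.ofReal_pow hr.le]
    simp [hV]
  have key : ∀ r : ℝ, 0 < r → ∀ f : E n → ℝ≥0∞, AEMeasurable f volume →
      ENNReal.ofReal r ^ n * V * ∫⁻ x, W x ^ p * (∫⁻ y in Metric.ball x r, f y) ^ p ≤
        C * (ENNReal.ofReal (4 * r) ^ n) ^ p *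
          (ENNReal.ofReal (4 * r) ^ n * ∫⁻ x, (W x * f x) ^ p) := by
    intro r hr f hf
    have hG : AEMeasurable (fun x => W x ^ p * (∫⁻ y in Metric.ball x r, f y) ^ p) volume :=
      (hW.pow_const _).mul ((measurable_setLIntegral_ball r hf).pow_const _).aemeasurable
    set G : E n → ℝ≥0∞ := fun x => W x ^ p * (∫⁻ y in Metric.ball x r, f y) ^ p with hGdef
    set S : Set (E n × E n) := {z | dist z.1 z.2 < r} with hS
    have hSm : MeasurableSet S := measurableSet_lt (by fun_prop) measurable_const
    calc ENNReal.ofReal r ^ n * V * ∫⁻ x, G x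
        = ∫⁻ x, ∫⁻ c, S.indicator (fun z => G z.1) (x, c) := by
          rw [← lintegral_const_mul'' _ hG]
          refine lintegral_congr fun x => ?_
          have : ∀ c, S.indicator (fun z => G z.1) (x, c)
              = (Metric.ball x r).indicator (fun _ => G x) c := fun c => by
            by_cases hc : c ∈ Metric.ball x r
            · rw [indicator_of_mem hc, indicator_of_mem]
              exact Metric.mem_ball'.1 hc
            · rw [indicator_of_notMem hc, indicator_of_notMem]
              exact fun h => hc (Metric.mem_ball'.2 h)
          simp only [this]
          rw [lintegral_indicator measurableSet_ball, setLIntegral_const, hball x hr, mul_comm]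
      _ = ∫⁻ c, ∫⁻ x, S.indicator (fun z => G z.1) (x, c) :=
          lintegral_lintegral_swap
            ((hG.comp_quasiMeasurePreserving Measure.quasiMeasurePreserving_fst).indicator hSm)
      _ ≤ ∫⁻ c, C * (ENNReal.ofReal (4 * r) ^ n) ^ p *
            ∫⁻ x in box c (2 * r), (W x * f x) ^ p := by
          refine lintegral_mono fun c => ?_
          have h1 : ∀ x, S.indicator (fun z => G z.1) (x, c) ≤ (box c (2 * r)).indicator
              (fun x => W x ^ p * (∫⁻ y in box c (2 * r), f y) ^ p) x := fun x => by
            by_cases hx : dist x c < r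
            · have hxb : x ∈ box c (2 * r) :=
                ball_subset_box c (2 * r) (Metric.mem_ball.2 (by linarith))
              rw [indicator_of_mem hxb, indicator_of_mem (show (x, c) ∈ S from hx), hGdef]
              dsimp only
              gcongr
              refine (Metric.ball_subset_ball' ?_).trans (ball_subset_box c (2 * r))
              linarith
            · rw [indicator_of_notMem (show (x, c) ∉ S from hx)]
              exact zero_le
          refine (lintegral_mono h1).trans ?_
          rw [lintegral_indicator (measurableSet_box c _),
            lintegral_mul_const'' _ (hW.pow_const _).restrict]
          refine lintegral_weight_mul_lintegral_rpow_le hp hW hW0 ?_ hf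
          have := hA (WithLp.toLp 2 fun i => c i - 2 * r) (2 * (2 * r)) (by positivity)
          rw [← box_eq_cube, box_eq_cube c, volume_cube] at this
          rw [box_eq_cube]
          refine this.trans_eq ?_
          congr 4
          ring
      _ = _ := by
          have hc : (C : ℝ≥0∞) * (ENNReal.ofReal (4 * r) ^ n) ^ p ≠ ∞ :=
            ENNReal.mul_ne_top (by simp)
              (ENNReal.rpow_ne_top_of_nonneg hp0.le (ENNReal.pow_ne_top ENNReal.ofReal_ne_top))
          rw [lintegral_const_mul' _ _ hc, lintegral_lintegral_box (h := fun x => (W x * f x) ^ p) _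
            ((hW.mul hf).pow_const _)]
          congr 4
          ring
  -- What is left of `key` after the powers `r^{np}` and `r^n` cancel; it no longer depends on `r`.
  set D : ℝ≥0∞ := C * ((4 : ℝ≥0∞) ^ n) ^ p * (4 ^ n) * V⁻¹ with hD
  have hDt : D ≠ ∞ := by
    refine ENNReal.mul_ne_top (ENNReal.mul_ne_top (ENNReal.mul_ne_top (by simp)
      (ENNReal.rpow_ne_top_of_nonneg hp0.le (by simp))) (by simp)) (by simpa using hV0)
  have hDp : D ^ (1 / p) ≠ ∞ := ENNReal.rpow_ne_top_of_nonneg (by positivity) hDt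
  refine ⟨(D ^ (1 / p)).toNNReal, fun r hr f hf => ?_⟩
  rw [ENNReal.coe_toNNReal hDp]
  have hpe : (ENNReal.ofReal p) ≠ 0 := by simpa using hp0
  have hr0 : ENNReal.ofReal r ≠ 0 := by simpa using hr
  have hrt : ENNReal.ofReal r ≠ ∞ := by simp
  simp only [eLpNorm_eq_lintegral_rpow_enorm_toReal hpe ENNReal.ofReal_ne_top, enorm_eq_self,
    ENNReal.toReal_ofReal hp0.le]
  rw [← ENNReal.mul_rpow_of_nonneg _ _ (by positivity)]
  refine ENNReal.rpow_le_rpow ?_ (by positivity)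
  set R := ENNReal.ofReal r ^ n with hR
  have hR0 : R ≠ 0 := pow_ne_zero _ hr0
  have hRt : R ≠ ∞ := ENNReal.pow_ne_top hrt
  have e1 : ∫⁻ x, (W x * ballAvg r f x) ^ p
      = (R⁻¹) ^ p * ∫⁻ x, W x ^ p * (∫⁻ y in Metric.ball x r, f y) ^ p := by
    rw [← lintegral_const_mul' _ _ (ENNReal.rpow_ne_top_of_nonneg hp0.le (by simpa using hR0))]
    refine lintegral_congr fun x => ?_
    rw [ballAvg, ENNReal.ofReal_pow hr.le, ENNReal.mul_rpow_of_nonneg _ _ hp0.le,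
      ENNReal.mul_rpow_of_nonneg _ _ hp0.le]
    ring
  have k := key r hr f hf
  rw [ENNReal.ofReal_mul (by norm_num), mul_pow, ← hR, show ENNReal.ofReal 4 = 4 by simp,
    ENNReal.mul_rpow_of_nonneg _ _ hp0.le] at k
  have hRp0 : R ^ p ≠ 0 := by simp [ENNReal.rpow_eq_zero_iff, hR0, hRt]
  have hRpt : R ^ p ≠ ∞ := ENNReal.rpow_ne_top_of_nonneg hp0.le hRt
  rw [e1, ENNReal.inv_rpow]
  have cancel : ∀ X : ℝ≥0∞, (R ^ p)⁻¹ * X = (R ^ p)⁻¹ * (R * V)⁻¹ * (R * V * X) := fun X => by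
    rw [mul_assoc, ← mul_assoc (R * V)⁻¹, ENNReal.inv_mul_cancel (mul_ne_zero hR0 hV0)
      (ENNReal.mul_ne_top hRt hVt), one_mul]
  rw [cancel]
  refine (mul_le_mul_right k _).trans_eq ?_
  rw [ENNReal.mul_inv (Or.inl hR0) (Or.inl hRt), hD]
  set X := ∫⁻ x, (W x * f x) ^ p
  calc _ = ((R ^ p)⁻¹ * R ^ p) * (R⁻¹ * R) * (C * ((4 : ℝ≥0∞) ^ n) ^ p * (4 ^ n) * V⁻¹ * X) := by
        ring
    _ = _ := by
        rw [ENNReal.inv_mul_cancel hRp0 hRpt, ENNReal.inv_mul_cancel hR0 hRt, one_mul, one_mul]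

/-! ### Muckenhoupt weights -/

theorem IsWeight.aemeasurable_enorm {w : E n → ℝ} (hw : IsWeight w) :
    AEMeasurable (fun x => ‖w x‖ₑ) volume :=
  hw.aemeasurable.enorm

theorem IsWeight.enorm_ne {w : E n → ℝ} (hw : IsWeight w) :
    ∀ᵐ x, ‖w x‖ₑ ≠ 0 ∧ ‖w x‖ₑ ≠ ∞ := by
  filter_upwards [hw.pos] with x hx
  simp [hx.ne']

theorem enorm_of_pos {a : ℝ} (ha : 0 < a) : ‖a‖ₑ = ENNReal.ofReal a := by
  rw [← ofReal_norm, Real.norm_of_nonneg ha.le]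

theorem IsWeight.decayBound_of_muckenhouptA {w : E n → ℝ} (hw : IsWeight w) {p : ℝ≥0∞}
    (hp : 1 < p) (hpt : p < ∞) (hA : MuckenhouptA p.toReal (fun x => w x ^ p.toReal)) :
    DecayBound p fun x => ‖w x‖ₑ := by
  have hp1 : 1 < p.toReal := by
    rw [← ENNReal.toReal_one]
    exact (ENNReal.toReal_lt_toReal ENNReal.one_ne_top hpt.ne).2 hp
  obtain ⟨C, hC⟩ := hA
  refine BallBound.decayBound hp.le hw.aemeasurable_enorm ?_
  rw [← ENNReal.ofReal_toReal hpt.ne]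
  refine ballBound_of_cubes hp1 hw.aemeasurable_enorm hw.enorm_ne (C := C) fun a l hl => ?_
  refine le_of_eq_of_le ?_ (hC a l hl)
  have hp1' : p.toReal - 1 ≠ 0 := by linarith
  have e1 : ∀ᵐ x, ‖w x‖ₑ ^ p.toReal = ENNReal.ofReal (w x ^ p.toReal) := by
    filter_upwards [hw.pos] with x hx
    rw [enorm_of_pos hx, ENNReal.ofReal_rpow_of_pos hx]
  -- The dual weight of `w^p` is `w^{-p'}`, since `p (1 - p') = -p'`.
  have e2 : ∀ᵐ x, ‖w x‖ₑ ^ (-(p.toReal / (p.toReal - 1)))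
      = ENNReal.ofReal ((w x ^ p.toReal) ^ (1 - p.toReal / (p.toReal - 1))) := by
    filter_upwards [hw.pos] with x hx
    rw [enorm_of_pos hx, ENNReal.ofReal_rpow_of_pos hx, ← Real.rpow_mul hx.le]
    congr 2
    field_simp
    ring
  rw [lintegral_congr_ae (ae_restrict_of_ae e1), lintegral_congr_ae (ae_restrict_of_ae e2)]

/-- With `M = ‖w f‖_∞` one has `f ≤ M w⁻¹`, and `A_1` bounds every ball average of `w⁻¹` at `x` by
`C w(x)⁻¹`; the factor `w(x)` then cancels. -/
theorem IsWeight.decayBound_of_muckenhouptAOne {w : E n → ℝ} (hw : IsWeight w)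
    (hA : MuckenhouptAOne (fun x => (w x)⁻¹)) : DecayBound ∞ fun x => ‖w x‖ₑ := by
  obtain ⟨C, hC⟩ := hA
  refine BallBound.decayBound le_top hw.aemeasurable_enorm ⟨C, fun r hr f hf => ?_⟩
  set M := eLpNorm (fun x => ‖w x‖ₑ * f x) ∞ volume with hM
  have h1 : ∀ᵐ x, f x ≤ M * ENNReal.ofReal (w x)⁻¹ := by
    have : ∀ᵐ x, ‖w x‖ₑ * f x ≤ M := by
      simpa [hM] using ae_le_eLpNormEssSup (f := fun x => ‖w x‖ₑ * f x) (μ := volume)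
    filter_upwards [this, hw.pos] with x hx hpos
    rw [ENNReal.ofReal_inv_of_pos hpos, ← div_eq_mul_inv, ENNReal.le_div_iff_mul_le
      (by simp [hpos]) (by simp), mul_comm, ← enorm_of_pos hpos]
    exact hx
  rw [eLpNorm_exponent_top]
  refine essSup_le_of_ae_le _ ?_
  filter_upwards [hC, hw.pos] with x hx hpos
  simp only [enorm_eq_self]
  have h2 : ballAvg r f x ≤ M * (C * ENNReal.ofReal (w x)⁻¹) := by
    refine le_trans ?_ (mul_le_mul_right hx M)
    have h3 : ∫⁻ y in Metric.ball x r, f y ≤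
        M * ∫⁻ y in Metric.ball x r, ENNReal.ofReal (w y)⁻¹ := by
      rw [← lintegral_const_mul'' (f := fun y => ENNReal.ofReal (w y)⁻¹) _
        hw.aemeasurable.inv.ennreal_ofReal.restrict]
      exact lintegral_mono_ae (ae_restrict_of_ae h1)
    calc ballAvg r f x ≤ (ENNReal.ofReal (r ^ n))⁻¹ *
          (M * ∫⁻ y in Metric.ball x r, ENNReal.ofReal (w y)⁻¹) := mul_le_mul_right h3 _
      _ = M * ((ENNReal.ofReal (r ^ n))⁻¹ *
          ∫⁻ y in Metric.ball x r, ENNReal.ofReal (w y)⁻¹) := by ring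
      _ ≤ _ := by
        gcongr
        exact le_iSup₂ (f := fun (r : ℝ) (_ : 0 < r) => (ENNReal.ofReal (r ^ n))⁻¹ *
          ∫⁻ y in Metric.ball x r, ENNReal.ofReal (w y)⁻¹) r hr
  refine (mul_le_mul_right h2 _).trans_eq ?_
  rw [enorm_of_pos hpos, ENNReal.ofReal_inv_of_pos hpos]
  calc _ = C * M * (ENNReal.ofReal (w x) * (ENNReal.ofReal (w x))⁻¹) := by ring
    _ = _ := by rw [ENNReal.mul_inv_cancel (by simpa using hpos) (by simp), mul_one]

theorem IsWeight.decayBound_of_admissible {w : E n → ℝ} (hw : IsWeight w) {p : ℝ≥0∞}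
    (hp : 1 < p) (hA : AdmissibleFactorWeight p w) : DecayBound p fun x => ‖w x‖ₑ := by
  rcases eq_or_ne p ∞ with rfl | hpt
  · exact hw.decayBound_of_muckenhouptAOne (hA.2 rfl)
  · exact hw.decayBound_of_muckenhouptA hp (lt_top_iff_ne_top.2 hpt)
      (hA.1 (lt_top_iff_ne_top.2 hpt))


/-! ### Functions of moderate growth in the mean -/

/-- The integral of `f` against `(1 + |y|)^{-(n+1)}`. -/
noncomputable def decayMass (f : E n → ℝ≥0∞) : ℝ≥0∞ := ∫⁻ y, decay 1 1 y * f y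

theorem decay_one_le_translate (x y : E n) :
    decay 1 1 y ≤ ENNReal.ofReal ((1 + ‖x‖) ^ (n + 1)) * decay 1 1 (x - y) := by
  rw [decay, decay, ← ENNReal.ofReal_mul (by positivity)]
  refine ENNReal.ofReal_le_ofReal ?_
  simp only [one_pow, one_mul]
  rw [mul_one_div, div_le_div_iff₀ (by positivity) (by positivity), one_mul, ← mul_pow]
  gcongr
  have h : ‖x - y‖ ≤ ‖x‖ + ‖y‖ := norm_sub_le x y
  nlinarith [norm_nonneg x, norm_nonneg y]

/-- From `1 + |y| ≤ (1 + t⁻¹)(1 + |x|)(1 + t|x - y|)`. With the preceding lemma, a decay average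
finite at one point for `t = 1` is finite at every point and every scale. -/
theorem decay_sub_le {t : ℝ} (ht : 0 < t) (x y : E n) :
    decay 1 t (x - y) ≤ ENNReal.ofReal (t ^ n * (1 + t⁻¹) ^ (n + 1)) *
      ENNReal.ofReal ((1 + ‖x‖) ^ (n + 1)) * decay 1 1 y := by
  rw [decay, decay, ← ENNReal.ofReal_mul (by positivity), ← ENNReal.ofReal_mul (by positivity)]
  refine ENNReal.ofReal_le_ofReal ?_
  simp only [one_pow, one_mul]
  rw [mul_one_div, div_le_div_iff₀ (by positivity) (by positivity), mul_assoc, mul_assoc,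
    ← mul_pow, ← mul_pow]
  gcongr
  have h : ‖y‖ ≤ ‖x‖ + ‖x - y‖ := by
    have := norm_sub_le x (x - y)
    rwa [sub_sub_cancel] at this
  have h1 : (1 + t⁻¹) * ((1 + ‖x‖) * (1 + t * ‖x - y‖))
      = (1 + ‖x‖) * (1 + t⁻¹ + t * ‖x - y‖ + ‖x - y‖) := by
    field_simp
    ring
  rw [h1]
  have h2 : 0 < t⁻¹ := by positivity
  have h3 : 0 ≤ t * ‖x - y‖ := by positivity
  have h4 : (1 + ‖x‖) * (1 + ‖x - y‖) ≤
      (1 + ‖x‖) * (1 + t⁻¹ + t * ‖x - y‖ + ‖x - y‖) := by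
    gcongr
    linarith
  nlinarith [norm_nonneg x, norm_nonneg (x - y)]

theorem decayMass_le (f : E n → ℝ≥0∞) (x : E n) :
    decayMass f ≤ ENNReal.ofReal ((1 + ‖x‖) ^ (n + 1)) * decayAvg 1 1 f x := by
  rw [decayAvg, ← lintegral_const_mul' _ _ ENNReal.ofReal_ne_top]
  refine lintegral_mono fun y => ?_
  rw [← mul_assoc]
  gcongr
  exact decay_one_le_translate x y

theorem decayAvg_le {t : ℝ} (ht : 0 < t) (f : E n → ℝ≥0∞) (x : E n) :
    decayAvg 1 t f x ≤ ENNReal.ofReal (t ^ n * (1 + t⁻¹) ^ (n + 1)) *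
      ENNReal.ofReal ((1 + ‖x‖) ^ (n + 1)) * decayMass f := by
  rw [decayMass, ← lintegral_const_mul' _ _
    (ENNReal.mul_ne_top ENNReal.ofReal_ne_top ENNReal.ofReal_ne_top)]
  refine lintegral_mono fun y => ?_
  rw [← mul_assoc]
  gcongr
  exact decay_sub_le ht x y

theorem decayAvg_lt_top {t : ℝ} (ht : 0 < t) {f : E n → ℝ≥0∞} (hf : decayMass f < ∞) (x : E n) :
    decayAvg 1 t f x < ∞ :=
  (decayAvg_le ht f x).trans_lt
    (ENNReal.mul_lt_top (ENNReal.mul_lt_top ENNReal.ofReal_lt_top ENNReal.ofReal_lt_top) hf)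

theorem decayMass_const_lt_top {c : ℝ≥0∞} (hc : c ≠ ∞) : decayMass (fun _ : E n => c) < ∞ := by
  rw [decayMass, lintegral_mul_const _ (measurable_decay 1 1)]
  refine ENNReal.mul_lt_top ?_ hc.lt_top
  have h := (integrable_one_add_norm (E := E n) (μ := volume) (r := (n : ℝ) + 1) (by simp)).2
  rw [HasFiniteIntegral] at h
  refine lt_of_eq_of_lt (lintegral_congr fun y => ?_) h
  rw [decay, enorm_of_pos (by positivity), Real.rpow_neg (by positivity), ← Nat.cast_add_one,
    Real.rpow_natCast]
  simp

theorem decayMass_add {f g : E n → ℝ≥0∞} (hf : AEMeasurable f volume) :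
    decayMass (fun x => f x + g x) = decayMass f + decayMass g := by
  simp only [decayMass, mul_add]
  exact lintegral_add_left' ((measurable_decay 1 1).aemeasurable.mul hf) _

/-- Boundedness of the averages makes the decay average of `f` finite at almost every point, and a
single such point controls the global integral. -/
theorem DecayBound.decayMass_lt_top {p : ℝ≥0∞} (hp : p ≠ 0) {W : E n → ℝ≥0∞}
    (h : DecayBound p W) (hW : AEMeasurable W volume) (hW0 : ∀ᵐ x, W x ≠ 0 ∧ W x ≠ ∞)
    {f : E n → ℝ≥0∞} (hf : AEMeasurable f volume)
    (hfin : eLpNorm (fun x => W x * f x) p volume < ∞) : decayMass f < ∞ := by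
  obtain ⟨C, hC⟩ := h
  have h1 : eLpNorm (fun x => W x * decayAvg 1 1 f x) p volume < ∞ :=
    (hC 1 one_pos f hf).trans_lt (ENNReal.mul_lt_top ENNReal.coe_lt_top hfin)
  have h2 := ae_lt_top_of_eLpNorm_lt_top hp (hW.mul (measurable_decayAvg 1 1 hf).aemeasurable) h1
  obtain ⟨x, hx, hx0⟩ := (h2.and hW0).exists
  refine (decayMass_le f x).trans_lt (ENNReal.mul_lt_top ENNReal.ofReal_lt_top ?_)
  by_contra hcon
  simp only [Pi.mul_apply, not_lt, top_le_iff] at hx hcon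
  rw [hcon, ENNReal.mul_top hx0.1] at hx
  exact lt_irrefl _ hx

theorem exists_one_add_norm_pow_mul_le (ψ : 𝓢(E n, ℂ)) (k : ℕ) :
    ∃ C : ℝ, 0 ≤ C ∧ ∀ x, (1 + ‖x‖) ^ k * ‖ψ x‖ ≤ C := by
  have h := fun x => ψ.one_add_le_sup_seminorm_apply (𝕜 := ℝ) (m := (k, 0)) le_rfl le_rfl x
  simp only [norm_iteratedFDeriv_zero] at h
  exact ⟨_, le_trans (by positivity) (h 0), h⟩

/-- The decay of a Schwartz function pays for the polynomial factor and still leaves `(1 +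
|x|)^{-(n+1)}`. The polynomial is there for products of two low-frequency parts. -/
theorem isTempered_of_le {f : E n → ℂ} (hf : AEStronglyMeasurable f volume) {F : E n → ℝ≥0∞}
    (k : ℕ) (hF : decayMass F < ∞)
    (hle : ∀ᵐ x, ‖f x‖ₑ ≤ ENNReal.ofReal ((1 + ‖x‖) ^ k) * F x) : IsTempered f := by
  intro ψ
  refine ⟨ψ.continuous.aestronglyMeasurable.mul hf, ?_⟩
  obtain ⟨C, hC0, hC⟩ := exists_one_add_norm_pow_mul_le ψ (k + (n + 1))
  have hψ : ∀ x, ‖ψ x‖ₑ * ENNReal.ofReal ((1 + ‖x‖) ^ k) ≤ ENNReal.ofReal C * decay 1 1 x := by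
    intro x
    rw [← ofReal_norm, decay, ← ENNReal.ofReal_mul (by positivity), ← ENNReal.ofReal_mul hC0]
    refine ENNReal.ofReal_le_ofReal ?_
    simp only [one_pow, one_mul]
    rw [mul_one_div, le_div_iff₀ (by positivity)]
    refine le_trans (le_of_eq ?_) (hC x)
    ring
  calc ∫⁻ x, ‖ψ x * f x‖ₑ ≤ ∫⁻ x, ENNReal.ofReal C * (decay 1 1 x * F x) := by
        refine lintegral_mono_ae ?_
        filter_upwards [hle] with x hx
        calc ‖ψ x * f x‖ₑ ≤ ‖ψ x‖ₑ * (ENNReal.ofReal ((1 + ‖x‖) ^ k) * F x) := by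
              rw [enorm_mul]
              gcongr
          _ = (‖ψ x‖ₑ * ENNReal.ofReal ((1 + ‖x‖) ^ k)) * F x := by ring
          _ ≤ ENNReal.ofReal C * decay 1 1 x * F x := mul_le_mul_left (hψ x) _
          _ = _ := by ring
    _ < ∞ := by
        rw [lintegral_const_mul' _ _ ENNReal.ofReal_ne_top]
        exact ENNReal.mul_lt_top ENNReal.ofReal_lt_top hF

theorem isTempered_of_decayMass {f : E n → ℂ} (hf : AEStronglyMeasurable f volume)
    (hF : decayMass (fun x => ‖f x‖ₑ) < ∞) : IsTempered f :=
  isTempered_of_le hf 0 hF (ae_of_all _ fun x => by simp)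

/-! ### Lebesgue points -/

theorem locallyIntegrable_of_decayMass {u : E n → ℂ} (hu : AEStronglyMeasurable u volume)
    (hm : decayMass (fun x => ‖u x‖ₑ) < ∞) : LocallyIntegrable u volume := by
  intro x
  refine ⟨Metric.ball x 1, Metric.ball_mem_nhds x one_pos, hu.restrict, ?_⟩
  have h : ∀ y ∈ Metric.ball x 1, ‖u y‖ₑ ≤
      ENNReal.ofReal ((2 + ‖x‖) ^ (n + 1)) * (decay 1 1 y * ‖u y‖ₑ) := fun y hy => by
    rw [← mul_assoc, decay, ← ENNReal.ofReal_mul (by positivity)]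
    refine le_mul_of_one_le_left zero_le ?_
    rw [ENNReal.one_le_ofReal]
    simp only [one_pow, one_mul]
    rw [mul_one_div, one_le_div (by positivity)]
    refine pow_le_pow_left₀ (by positivity) ?_ _
    have h1 := norm_le_norm_add_norm_sub' y x
    rw [Metric.mem_ball, dist_eq_norm] at hy
    linarith
  calc ∫⁻ y in Metric.ball x 1, ‖u y‖ₑ
      ≤ ∫⁻ y in Metric.ball x 1, ENNReal.ofReal ((2 + ‖x‖) ^ (n + 1)) * (decay 1 1 y * ‖u y‖ₑ) :=
        setLIntegral_mono' measurableSet_ball h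
    _ ≤ ∫⁻ y, ENNReal.ofReal ((2 + ‖x‖) ^ (n + 1)) * (decay 1 1 y * ‖u y‖ₑ) :=
        setLIntegral_le_lintegral _ _
    _ < ∞ := by
        rw [lintegral_const_mul' _ _ ENNReal.ofReal_ne_top]
        exact ENNReal.mul_lt_top ENNReal.ofReal_lt_top hm

/-- On `B_r(x)` with `r ≥ δ` one has `1 + |x - y| ≤ (δ⁻¹ + 1) r`. Integrability against a kernel of
order `n + 1` therefore allows ball averages to grow at most linearly in `r`. -/
theorem ballAvg_le_decayAvg {δ : ℝ} (hδ : 0 < δ) {r : ℝ} (hr : δ ≤ r) (h : E n → ℝ≥0∞) (x : E n) :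
    ballAvg r h x ≤ ENNReal.ofReal ((δ⁻¹ + 1) ^ (n + 1)) * decayAvg 1 1 h x *
      ENNReal.ofReal r := by
  have hr0 : 0 < r := hδ.trans_le hr
  have h1 : ∀ y ∈ Metric.ball x r, (ENNReal.ofReal (r ^ n))⁻¹ * h y ≤
      ENNReal.ofReal ((δ⁻¹ + 1) ^ (n + 1)) * ENNReal.ofReal r * (decay 1 1 (x - y) * h y) := by
    intro y hy
    rw [← mul_assoc]
    gcongr
    rw [decay, ← ENNReal.ofReal_inv_of_pos (by positivity), ← ENNReal.ofReal_mul (by positivity),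
      ← ENNReal.ofReal_mul (by positivity)]
    refine ENNReal.ofReal_le_ofReal ?_
    simp only [one_pow, one_mul]
    rw [mul_one_div, le_div_iff₀ (by positivity)]
    rw [Metric.mem_ball', dist_eq_norm] at hy
    have h2 : 1 + ‖x - y‖ ≤ (δ⁻¹ + 1) * r := by
      have : 1 ≤ δ⁻¹ * r := by
        rw [← div_eq_inv_mul, one_le_div hδ]
        exact hr
      linarith
    calc (r ^ n)⁻¹ * (1 + ‖x - y‖) ^ (n + 1) ≤ (r ^ n)⁻¹ * ((δ⁻¹ + 1) * r) ^ (n + 1) := by gcongr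
      _ = _ := by
        rw [mul_pow, pow_succ r]
        field_simp
  have hrn : (ENNReal.ofReal (r ^ n))⁻¹ ≠ ∞ := by
    simpa using pow_pos hr0 n
  calc ballAvg r h x = ∫⁻ y in Metric.ball x r, (ENNReal.ofReal (r ^ n))⁻¹ * h y := by
        rw [ballAvg, lintegral_const_mul' _ _ hrn]
    _ ≤ ∫⁻ y, ENNReal.ofReal ((δ⁻¹ + 1) ^ (n + 1)) * ENNReal.ofReal r *
          (decay 1 1 (x - y) * h y) :=
        (setLIntegral_mono' measurableSet_ball h1).trans (setLIntegral_le_lintegral _ _)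
    _ = _ := by
        rw [lintegral_const_mul' _ _ (by finiteness), decayAvg]
        ring

theorem tendsto_ballAvg_of_average {u : E n → ℂ} (hu : LocallyIntegrable u volume) {x : E n}
    (hx : Filter.Tendsto (fun a => ⨍ y in a, ‖u y - u x‖)
      ((Besicovitch.vitaliFamily (volume : Measure (E n))).filterAt x) (nhds 0)) :
    Filter.Tendsto (fun r => ballAvg r (fun y => ‖u y - u x‖ₑ) x) (nhdsWithin 0 (Ioi 0))
      (nhds 0) := by
  have h1 := hx.comp (Besicovitch.tendsto_filterAt volume x)
  set V : ℝ≥0∞ := volume (Metric.ball (0 : E n) 1) with hV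
  have hVt : V ≠ ∞ := measure_ball_lt_top.ne
  have h2 := ENNReal.Tendsto.const_mul (a := V) (ENNReal.tendsto_ofReal h1) (Or.inr hVt)
  rw [ENNReal.ofReal_zero, mul_zero] at h2
  refine tendsto_of_tendsto_of_tendsto_of_le_of_le' tendsto_const_nhds h2
    (Filter.Eventually.of_forall fun _ => zero_le) ?_
  filter_upwards [self_mem_nhdsWithin] with r hr
  rw [mem_Ioi] at hr
  have hball : volume (Metric.closedBall x r) = ENNReal.ofReal (r ^ n) * V := by
    rw [Measure.addHaar_closedBall volume x hr.le]
    simp [hV]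
  have hint : IntegrableOn (fun y => u y - u x) (Metric.closedBall x r) volume :=
    (hu.integrableOn_isCompact (isCompact_closedBall x r)).sub
      (integrableOn_const measure_closedBall_lt_top.ne)
  have havg : ENNReal.ofReal (⨍ y in Metric.closedBall x r, ‖u y - u x‖)
      = (volume (Metric.closedBall x r))⁻¹ * ∫⁻ y in Metric.closedBall x r, ‖u y - u x‖ₑ := by
    rw [setAverage_eq, smul_eq_mul, ENNReal.ofReal_mul (by positivity),
      ofReal_integral_norm_eq_lintegral_enorm hint, Measure.real, ENNReal.ofReal_inv_of_pos,
      ENNReal.ofReal_toReal measure_closedBall_lt_top.ne]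
    exact ENNReal.toReal_pos (Metric.measure_closedBall_pos volume x hr).ne'
      measure_closedBall_lt_top.ne
  simp only [Function.comp_apply]
  have hV0 : V ≠ 0 := (Metric.measure_ball_pos volume _ one_pos).ne'
  rw [havg, hball, ENNReal.mul_inv (Or.inr hVt) (Or.inr hV0), ballAvg, ← mul_assoc,
    mul_comm (ENNReal.ofReal (r ^ n))⁻¹ V⁻¹, ← mul_assoc, ENNReal.mul_inv_cancel hV0 hVt, one_mul]
  gcongr
  exact Metric.ball_subset_closedBall

/-- At a Lebesgue point, averages of `|u - u(x)|` over small balls are small, and over large balls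
they grow at most linearly in the radius. The kernel of order `n + 2` weights the radius `2^{m-k}`
by `4^{-m}`, so the large radii contribute `O(2^{-k})`; with order `n + 1` this bound would diverge.
-/
theorem ae_tendsto_decayAvg {u : E n → ℂ} (hu : AEStronglyMeasurable u volume)
    (hm : decayMass (fun x => ‖u x‖ₑ) < ∞) :
    ∀ᵐ x, Filter.Tendsto (fun k : ℕ => decayAvg 2 (2 ^ k) (fun y => ‖u y - u x‖ₑ) x)
      Filter.atTop (nhds 0) := by
  have hloc := locallyIntegrable_of_decayMass hu hm
  filter_upwards [(Besicovitch.vitaliFamily volume).ae_tendsto_average_norm_sub hloc] with x hx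
  have hlim := tendsto_ballAvg_of_average hloc hx
  set h : E n → ℝ≥0∞ := fun y => ‖u y - u x‖ₑ with hh
  have hhm : AEMeasurable h volume := (hu.sub aestronglyMeasurable_const).enorm
  have hT : decayAvg 1 1 h x < ∞ := by
    refine decayAvg_lt_top one_pos ?_ x
    calc decayMass h ≤ decayMass (fun y => ‖u y‖ₑ + ‖u x‖ₑ) := by
          unfold decayMass
          gcongr with y
          exact enorm_sub_le
      _ < ∞ := by
          rw [decayMass_add hu.enorm]
          exact ENNReal.add_lt_top.2 ⟨hm, decayMass_const_lt_top enorm_ne_top⟩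
  rw [ENNReal.tendsto_nhds_zero]
  intro ε hε
  rcases eq_or_ne ε ∞ with rfl | hεt
  · simp
  -- Chosen so that the constant `2^{n+2}` of the ball decomposition and the geometric sum `2` turn
  -- it into `ε / 2`.
  set ε' : ℝ≥0∞ := ε / 2 / (2 ^ (n + 2) * 2) with hε'
  have hε'0 : 0 < ε' := ENNReal.div_pos (ENNReal.half_pos hε.ne').ne' (by finiteness)
  obtain ⟨δ, hδ, hδ'⟩ := mem_nhdsGT_iff_exists_Ioo_subset.1
    ((ENNReal.tendsto_nhds_zero.1 hlim) ε' hε'0)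
  rw [mem_Ioi] at hδ
  set A : ℝ≥0∞ := ENNReal.ofReal ((δ⁻¹ + 1) ^ (n + 1)) * decayAvg 1 1 h x with hA
  have hAt : A ≠ ∞ := ENNReal.mul_ne_top ENNReal.ofReal_ne_top hT.ne
  have hle : ∀ r : ℝ, 0 < r → ballAvg r h x ≤ ε' + A * ENNReal.ofReal r := by
    intro r hr
    rcases lt_or_ge r δ with h1 | h1
    · exact le_add_right (hδ' ⟨hr, h1⟩)
    · exact le_add_left (ballAvg_le_decayAvg hδ h1 h x)
  have hbound : ∀ k : ℕ, decayAvg 2 (2 ^ k) h x ≤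
      ε / 2 + 2 ^ (n + 2) * 2 * A * (2⁻¹ : ℝ≥0∞) ^ k := by
    intro k
    refine (decayAvg_le_tsum 2 (by positivity) hhm x).trans ?_
    have h2 : ∀ m : ℕ, (2⁻¹ : ℝ≥0∞) ^ (2 * m) * ballAvg (2 ^ m / 2 ^ k) h x ≤
        (2⁻¹ : ℝ≥0∞) ^ m * ε' + (2⁻¹ : ℝ≥0∞) ^ m * (A * (2⁻¹ : ℝ≥0∞) ^ k) := by
      intro m
      have h3 : ENNReal.ofReal (2 ^ m / 2 ^ k) = 2 ^ m * (2⁻¹ : ℝ≥0∞) ^ k := by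
        rw [div_eq_mul_inv, ENNReal.ofReal_mul (by positivity), ENNReal.ofReal_pow (by positivity),
          ENNReal.ofReal_inv_of_pos (by positivity), ENNReal.ofReal_pow (by positivity),
          ENNReal.inv_pow]
        simp
      have h4 : (2⁻¹ : ℝ≥0∞) ^ m * 2 ^ m = 1 := by
        rw [← mul_pow, ENNReal.inv_mul_cancel (by simp) (by simp), one_pow]
      have h5 : (2⁻¹ : ℝ≥0∞) ^ (2 * m) ≤ (2⁻¹ : ℝ≥0∞) ^ m :=
        pow_le_pow_right_of_le_one' (by simp [ENNReal.inv_le_one]) (by omega)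
      calc _ ≤ (2⁻¹ : ℝ≥0∞) ^ (2 * m) * (ε' + A * ENNReal.ofReal (2 ^ m / 2 ^ k)) := by
            gcongr
            exact hle _ (by positivity)
        _ = (2⁻¹ : ℝ≥0∞) ^ (2 * m) * ε' + (2⁻¹ : ℝ≥0∞) ^ m * ((2⁻¹ : ℝ≥0∞) ^ m * 2 ^ m) *
            (A * (2⁻¹ : ℝ≥0∞) ^ k) := by
            rw [h3, two_mul, pow_add]
            ring
        _ ≤ _ := by
            rw [h4, mul_one]
            gcongr
    calc _ ≤ 2 ^ (n + 2) * ∑' m : ℕ, ((2⁻¹ : ℝ≥0∞) ^ m * ε' +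
          (2⁻¹ : ℝ≥0∞) ^ m * (A * (2⁻¹ : ℝ≥0∞) ^ k)) := by
          gcongr with m
          exact h2 m
      _ = (2 ^ (n + 2) * 2) * ε' + 2 ^ (n + 2) * 2 * A * (2⁻¹ : ℝ≥0∞) ^ k := by
          rw [ENNReal.tsum_add, ENNReal.tsum_mul_right, ENNReal.tsum_mul_right, tsum_two_inv_pow]
          ring
      _ = _ := by
          rw [hε', ENNReal.mul_div_cancel (by simp) (by finiteness)]
  have hpow : Filter.Tendsto (fun k : ℕ => 2 ^ (n + 2) * 2 * A * (2⁻¹ : ℝ≥0∞) ^ k)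
      Filter.atTop (nhds 0) := by
    have h1 : Filter.Tendsto (fun k : ℕ => (2⁻¹ : ℝ≥0∞) ^ k) Filter.atTop (nhds 0) :=
      ENNReal.tendsto_pow_atTop_nhds_zero_iff.2 (by simp)
    have h2 := ENNReal.Tendsto.const_mul (a := 2 ^ (n + 2) * 2 * A) h1 (Or.inr (by finiteness))
    rwa [mul_zero] at h2
  filter_upwards [(ENNReal.tendsto_nhds_zero.1 hpow) (ε / 2) (ENNReal.half_pos hε.ne')] with k hk
  refine (hbound k).trans ?_
  calc _ ≤ ε / 2 + ε / 2 := by gcongr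
    _ = ε := ENNReal.add_halves ε


/-! ### Radial Fourier multipliers -/

/-- The profile of a smooth, compactly supported radial symbol. -/
structure IsRadialProfile (g : ℝ → ℝ) : Prop where
  smooth : ContDiff ℝ ((⊤ : ℕ∞) : WithTop ℕ∞) g
  eq_zero : ∃ b : ℝ, ∀ r, b < r → g r = 0
  eq_const : ∃ ε : ℝ, 0 < ε ∧ ∀ r, r < ε → g r = g 0

/-- The symbol of `g(2⁻ʲ D)`. -/
noncomputable def symbol (g : ℝ → ℝ) (j : ℤ) (ξ : E n) : ℂ :=
  ((g ((2 : ℝ) ^ (-j) * (2 * Real.pi * ‖ξ‖)) : ℝ) : ℂ)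

theorem lpKernel_eq (g : ℝ → ℝ) (j : ℤ) : lpKernel (n := n) g j = 𝓕⁻ (symbol (n := n) g j) := rfl

namespace IsRadialProfile

variable {g : ℝ → ℝ} (hg : IsRadialProfile g)
include hg

theorem hasCompactSupport_symbol (j : ℤ) : HasCompactSupport (symbol (n := n) g j) := by
  obtain ⟨b, hb⟩ := hg.eq_zero
  have hc : (0 : ℝ) < (2 : ℝ) ^ (-j) * (2 * Real.pi) := by positivity
  refine HasCompactSupport.of_support_subset_isCompact
    (isCompact_closedBall (0 : E n) (b / ((2 : ℝ) ^ (-j) * (2 * Real.pi)))) fun ξ hξ => ?_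
  rw [mem_closedBall_zero_iff, le_div_iff₀ hc]
  by_contra hcon
  refine hξ ?_
  rw [symbol, hb _ (by linarith), Complex.ofReal_zero]

/-- The norm is not smooth at the origin, but there the profile is locally constant. -/
theorem contDiff_symbol (j : ℤ) :
    ContDiff ℝ ((⊤ : ℕ∞) : WithTop ℕ∞) (symbol (n := n) g j) := by
  have hc : (0 : ℝ) < (2 : ℝ) ^ (-j) * (2 * Real.pi) := by positivity
  rw [contDiff_iff_contDiffAt]
  intro ξ
  rcases eq_or_ne ξ 0 with rfl | hξ
  · obtain ⟨ε, hε, h⟩ := hg.eq_const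
    have : symbol (n := n) g j =ᶠ[nhds 0] fun _ => ((g 0 : ℝ) : ℂ) := by
      filter_upwards [Metric.ball_mem_nhds (0 : E n)
        (show 0 < ε / ((2 : ℝ) ^ (-j) * (2 * Real.pi)) by positivity)] with ξ hξ
      rw [mem_ball_zero_iff, lt_div_iff₀ hc] at hξ
      rw [symbol, h _ (by linarith)]
    exact contDiffAt_const.congr_of_eventuallyEq this
  · have h1 : ContDiffAt ℝ ((⊤ : ℕ∞) : WithTop ℕ∞)
        (fun ξ : E n => (2 : ℝ) ^ (-j) * (2 * Real.pi * ‖ξ‖)) ξ :=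
      contDiffAt_const.mul (contDiffAt_const.mul (contDiffAt_norm ℝ hξ))
    exact Complex.ofRealCLM.contDiff.contDiffAt.comp ξ (hg.smooth.contDiffAt.comp ξ h1)

/-- The symbol of `g(2⁻ʲ D)` as a Schwartz function. -/
theorem exists_schwartz_symbol (j : ℤ) : ∃ S : 𝓢(E n, ℂ), ⇑S = symbol (n := n) g j :=
  ⟨(hg.hasCompactSupport_symbol j).toSchwartzMap (hg.contDiff_symbol j), rfl⟩

theorem exists_schwartz_lpKernel (j : ℤ) : ∃ K : 𝓢(E n, ℂ), ⇑K = lpKernel (n := n) g j := by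
  obtain ⟨S, hS⟩ := hg.exists_schwartz_symbol (n := n) j
  exact ⟨𝓕⁻ S, by rw [SchwartzMap.fourierInv_coe, hS, lpKernel_eq]⟩

theorem fourier_lpKernel (j : ℤ) : 𝓕 (lpKernel (n := n) g j) = symbol (n := n) g j := by
  obtain ⟨S, hS⟩ := hg.exists_schwartz_symbol (n := n) j
  have h : 𝓕 (𝓕⁻ S) = S := FourierTransform.fourier_fourierInv_eq S
  have := congrArg (fun T : 𝓢(E n, ℂ) => (T : E n → ℂ)) h
  rw [SchwartzMap.fourier_coe, SchwartzMap.fourierInv_coe, hS] at this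
  exact this

theorem continuous_lpKernel (j : ℤ) : Continuous (lpKernel (n := n) g j) := by
  obtain ⟨K, hK⟩ := hg.exists_schwartz_lpKernel (n := n) j
  rw [← hK]
  exact K.continuous

theorem integrable_lpKernel (j : ℤ) : Integrable (lpKernel (n := n) g j) := by
  obtain ⟨K, hK⟩ := hg.exists_schwartz_lpKernel (n := n) j
  rw [← hK]
  exact K.integrable

theorem integrable_symbol (j : ℤ) : Integrable (symbol (n := n) g j) := by
  obtain ⟨K, hK⟩ := hg.exists_schwartz_symbol (n := n) j
  rw [← hK]
  exact K.integrable

theorem integral_lpKernel (j : ℤ) : ∫ x, lpKernel (n := n) g j x = ((g 0 : ℝ) : ℂ) := by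
  have h := congrFun (hg.fourier_lpKernel (n := n) j) 0
  rw [Real.fourier_eq'] at h
  simpa [symbol] using h

end IsRadialProfile

/-- Reduces bounds on all kernels to the Schwartz decay of the one with `j = 0`, so that constants
do not depend on `j`. -/
theorem lpKernel_scaling (g : ℝ → ℝ) (j : ℤ) (x : E n) :
    lpKernel g j x = (((2 : ℝ) ^ j) ^ n : ℝ) • lpKernel g 0 ((2 : ℝ) ^ j • x) := by
  rw [lpKernel_eq, lpKernel_eq, Real.fourierInv_eq', Real.fourierInv_eq']
  have h := Measure.integral_comp_smul (volume : Measure (E n)) (fun ξ : E n =>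
    Complex.exp (((2 * Real.pi * inner ℝ ξ ((2 : ℝ) ^ j • x) : ℝ) : ℂ) * Complex.I) •
      symbol g 0 ξ) ((2 : ℝ) ^ (-j))
  have hpos : (0 : ℝ) < (2 : ℝ) ^ (-j) := by positivity
  have h2 : |(((2 : ℝ) ^ (-j)) ^ Module.finrank ℝ (E n))⁻¹| = ((2 : ℝ) ^ j) ^ n := by
    rw [abs_of_pos (by positivity)]
    simp
  rw [h2] at h
  rw [← h]
  congr 1
  ext ξ
  rw [real_inner_smul_left, real_inner_smul_right, ← mul_assoc ((2 : ℝ) ^ (-j)),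
    ← zpow_add₀ two_ne_zero]
  simp only [neg_add_cancel, zpow_zero, one_mul, symbol, norm_smul, Real.norm_of_nonneg hpos.le,
    neg_zero]
  rw [show (2 : ℝ) ^ (-j) * (2 * Real.pi * ‖ξ‖) = 2 * Real.pi * (2 ^ (-j) * ‖ξ‖) by ring]

namespace IsRadialProfile

variable {g : ℝ → ℝ} (hg : IsRadialProfile g)
include hg

theorem exists_enorm_lpKernel_le (i : ℕ) : ∃ C : ℝ≥0, ∀ (j : ℤ) (x : E n),
    ‖lpKernel g j x‖ₑ ≤ C * decay i ((2 : ℝ) ^ j) x := by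
  obtain ⟨K, hK⟩ := hg.exists_schwartz_lpKernel (n := n) 0
  obtain ⟨C, hC0, hC⟩ := exists_one_add_norm_pow_mul_le K (n + i)
  refine ⟨C.toNNReal, fun j x => ?_⟩
  have hpos : (0 : ℝ) < (2 : ℝ) ^ j := by positivity
  rw [← ofReal_norm, decay, ← ENNReal.ofReal, ← ENNReal.ofReal_mul hC0, lpKernel_scaling, norm_smul,
    Real.norm_of_nonneg (by positivity), ← hK]
  refine ENNReal.ofReal_le_ofReal ?_
  have h := hC ((2 : ℝ) ^ j • x)
  rw [norm_smul, Real.norm_of_nonneg hpos.le] at h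
  rw [← mul_div_assoc, le_div_iff₀ (by positivity)]
  calc _ = ((2 : ℝ) ^ j) ^ n * ((1 + 2 ^ j * ‖x‖) ^ (n + i) * ‖K ((2 : ℝ) ^ j • x)‖) := by ring
    _ ≤ ((2 : ℝ) ^ j) ^ n * C := by gcongr
    _ = _ := mul_comm _ _

theorem lintegral_lpKernel_mul_le (i : ℕ) : ∃ C : ℝ≥0, ∀ (j : ℤ) (f : E n → ℝ≥0∞) (x : E n),
    ∫⁻ y, ‖lpKernel g j (x - y)‖ₑ * f y ≤ C * decayAvg i ((2 : ℝ) ^ j) f x := by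
  obtain ⟨C, hC⟩ := hg.exists_enorm_lpKernel_le (n := n) i
  refine ⟨C, fun j f x => ?_⟩
  rw [decayAvg, ← lintegral_const_mul' _ _ ENNReal.coe_ne_top]
  refine lintegral_mono fun y => ?_
  rw [← mul_assoc]
  gcongr
  exact hC j _

theorem enorm_lpProj_le (i : ℕ) : ∃ C : ℝ≥0, ∀ (j : ℤ) (f : E n → ℂ) (x : E n),
    ‖lpProj g j f x‖ₑ ≤ C * decayAvg i ((2 : ℝ) ^ j) (fun y => ‖f y‖ₑ) x := by
  obtain ⟨C, hC⟩ := hg.lintegral_lpKernel_mul_le (n := n) i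
  refine ⟨C, fun j f x => ?_⟩
  refine (enorm_integral_le_lintegral_enorm _).trans ?_
  simp only [enorm_mul]
  exact hC j _ x

theorem aestronglyMeasurable_kernel_mul (j : ℤ) {f : E n → ℂ}
    (hf : AEStronglyMeasurable f volume) (x : E n) :
    AEStronglyMeasurable (fun y => lpKernel g j (x - y) * f y) volume :=
  ((hg.continuous_lpKernel j).comp (continuous_const.sub continuous_id)).aestronglyMeasurable.mul hf

theorem lintegral_enorm_kernel_lt_top (j : ℤ) {f : E n → ℝ≥0∞} (hf : decayMass f < ∞) (x : E n) :
    ∫⁻ y, ‖lpKernel g j (x - y)‖ₑ * f y < ∞ := by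
  obtain ⟨C, hC⟩ := hg.lintegral_lpKernel_mul_le (n := n) 1
  exact (hC j f x).trans_lt (ENNReal.mul_lt_top ENNReal.coe_lt_top
    (decayAvg_lt_top (by positivity) hf x))

theorem integrable_kernel_mul (j : ℤ) {f : E n → ℂ}
    (hf : AEStronglyMeasurable f volume) (hm : decayMass (fun y => ‖f y‖ₑ) < ∞) (x : E n) :
    Integrable (fun y => lpKernel g j (x - y) * f y) := by
  refine ⟨hg.aestronglyMeasurable_kernel_mul j hf x, ?_⟩
  rw [HasFiniteIntegral]
  simp only [enorm_mul]
  exact hg.lintegral_enorm_kernel_lt_top j hm x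

theorem aestronglyMeasurable_lpProj (j : ℤ) {f : E n → ℂ}
    (hf : AEStronglyMeasurable f volume) : AEStronglyMeasurable (lpProj g j f) volume := by
  refine AEStronglyMeasurable.integral_prod_right' (f := fun z : E n × E n =>
    lpKernel g j (z.1 - z.2) * f z.2) ?_
  exact ((hg.continuous_lpKernel j).comp (continuous_fst.sub continuous_snd)).aestronglyMeasurable.mul
    (hf.comp_quasiMeasurePreserving Measure.quasiMeasurePreserving_snd)

theorem lpProj_const (j : ℤ) (c : ℂ) (x : E n) : lpProj g j (fun _ => c) x = (g 0 : ℝ) * c := by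
  rw [lpProj, integral_mul_const, integral_sub_left_eq_self (fun y => lpKernel g j y) volume x,
    hg.integral_lpKernel]

/-- If `g 0 = 1` then `g(2⁻ᵏ D)` is an approximation of the identity. -/
theorem ae_tendsto_lpProj (h1 : g 0 = 1) {u : E n → ℂ} (hu : AEStronglyMeasurable u volume)
    (hm : decayMass (fun x => ‖u x‖ₑ) < ∞) :
    ∀ᵐ x, Filter.Tendsto (fun k : ℕ => lpProj g (k : ℤ) u x) Filter.atTop (nhds (u x)) := by
  obtain ⟨C, hC⟩ := hg.enorm_lpProj_le (n := n) 2
  filter_upwards [ae_tendsto_decayAvg hu hm] with x hx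
  -- Since `g 0 = 1`, the multiplier reproduces the constant `u x`.
  have hsub : ∀ k : ℤ, lpProj g k u x - u x = lpProj g k (fun y => u y - u x) x := fun k => by
    have hc : Integrable fun y => lpKernel g k (x - y) * u x :=
      ((hg.integrable_lpKernel k).comp_sub_left x).mul_const _
    have := hg.lpProj_const k (u x) x
    rw [h1, Complex.ofReal_one, one_mul] at this
    conv_lhs => rw [← this]
    simp only [lpProj, mul_sub]
    rw [integral_sub (hg.integrable_kernel_mul k hu hm x) hc]
  rw [tendsto_iff_edist_tendsto_0]
  have h2 := ENNReal.Tendsto.const_mul (a := (C : ℝ≥0∞)) hx (Or.inr ENNReal.coe_ne_top)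
  rw [mul_zero] at h2
  refine tendsto_of_tendsto_of_tendsto_of_le_of_le tendsto_const_nhds h2
    (fun _ => zero_le) fun k => ?_
  dsimp only
  rw [edist_eq_enorm_sub, hsub]
  have := hC (k : ℤ) (fun y => u y - u x) x
  rwa [zpow_natCast] at this

theorem lpProj_weighted_bound {p : ℝ≥0∞} {W : E n → ℝ≥0∞} (hW : DecayBound p W) :
    ∃ C : ℝ≥0, ∀ (j : ℤ) (f : E n → ℂ), AEStronglyMeasurable f volume →
      eLpNorm (fun x => W x * ‖lpProj g j f x‖ₑ) p volume ≤
        C * eLpNorm (fun x => W x * ‖f x‖ₑ) p volume := by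
  obtain ⟨C, hC⟩ := hg.enorm_lpProj_le (n := n) 1
  obtain ⟨D, hD⟩ := hW
  refine ⟨C * D, fun j f hf => ?_⟩
  calc _ ≤ C * eLpNorm (fun x => W x * decayAvg 1 ((2 : ℝ) ^ j) (fun y => ‖f y‖ₑ) x) p volume := by
        refine eLpNorm_nnreal_mul_le (ae_of_all _ fun x => ?_)
        rw [mul_left_comm]
        gcongr
        exact hC j f x
    _ ≤ C * (D * eLpNorm (fun x => W x * ‖f x‖ₑ) p volume) := by
        gcongr
        exact hD _ (by positivity) _ hf.enorm
    _ = _ := by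
        push_cast
        ring

end IsRadialProfile


/-! ### The low-frequency cut-off -/

theorem IsLittlewoodPaley.exists_bounds {φ : ℝ → ℝ} (hφ : IsLittlewoodPaley φ) :
    ∃ a b : ℝ, 0 < a ∧ 0 < b ∧ (∀ r, r < a → φ r = 0) ∧ ∀ r, b < r → φ r = 0 := by
  obtain ⟨R, hR⟩ := hφ.compact.isBounded.subset_closedBall 0
  have h0 : (0 : ℝ) ∉ tsupport φ := fun h => (lt_irrefl (0 : ℝ)) (hφ.support_pos h)
  obtain ⟨a, ha, hball⟩ := Metric.isOpen_iff.1 (isClosed_tsupport φ).isOpen_compl 0 h0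
  refine ⟨a, max R 1, ha, by positivity, fun r hr => ?_, fun r hr => ?_⟩
  · by_contra hcon
    have hmem : r ∈ tsupport φ := subset_tsupport φ hcon
    have hpos : 0 < r := hφ.support_pos hmem
    refine hball ?_ hmem
    rw [mem_ball_zero_iff, Real.norm_of_nonneg hpos.le]
    exact hr
  · by_contra hcon
    have hmem := hR (subset_tsupport φ hcon)
    rw [mem_closedBall_zero_iff, Real.norm_eq_abs] at hmem
    have := (le_abs_self r).trans hmem
    exact absurd hr (not_lt.2 (this.trans (le_max_left _ _)))

theorem IsLittlewoodPaley.isRadialProfile {φ : ℝ → ℝ} (hφ : IsLittlewoodPaley φ) :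
    IsRadialProfile φ := by
  obtain ⟨a, b, ha, -, h1, h2⟩ := hφ.exists_bounds
  exact ⟨hφ.smooth, ⟨b, h2⟩, ⟨a, ha, fun r hr => by rw [h1 r hr, h1 0 ha]⟩⟩

/-- The profile of the low-frequency cut-off `∑_{j ≤ 0} P_j`, which is `1` near the origin. -/
noncomputable def lowPass (φ : ℝ → ℝ) (r : ℝ) : ℝ :=
  1 - ∑' m : ℕ, φ ((2 : ℝ) ^ (-((m : ℤ) + 1)) * r)

theorem exists_pow_neg_mul_lt {a : ℝ} (ha : 0 < a) (R : ℝ) :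
    ∃ M : ℕ, ∀ m : ℕ, M ≤ m → ∀ r, r < R → (2 : ℝ) ^ (-((m : ℤ) + 1)) * r < a := by
  obtain ⟨M, hM⟩ := pow_unbounded_of_one_lt (R / a) (one_lt_two (α := ℝ))
  refine ⟨M, fun m hm r hr => ?_⟩
  have h1 : (2 : ℝ) ^ M ≤ (2 : ℝ) ^ ((m : ℤ) + 1) := by
    rw [← zpow_natCast]
    exact zpow_le_zpow_right₀ one_le_two (by omega)
  have hpos : (0 : ℝ) < (2 : ℝ) ^ ((m : ℤ) + 1) := by positivity
  rw [zpow_neg, inv_mul_lt_iff₀ hpos]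
  rw [div_lt_iff₀ ha] at hM
  nlinarith

/-- The high-frequency sum is locally finite, also near `r = 0`. The low-frequency sum is not, and
it vanishes at `0`, which is why the cut-off is defined by subtraction from `1`. -/
theorem lowPass_eq_sum {φ : ℝ → ℝ} {a : ℝ} (h1 : ∀ r, r < a → φ r = 0) {M : ℕ} {r : ℝ}
    (hM : ∀ m : ℕ, M ≤ m → (2 : ℝ) ^ (-((m : ℤ) + 1)) * r < a) :
    lowPass φ r = 1 - ∑ m ∈ Finset.range M, φ ((2 : ℝ) ^ (-((m : ℤ) + 1)) * r) := by
  rw [lowPass, tsum_eq_sum]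
  intro m hm
  exact h1 _ (hM m (by simpa using hm))

theorem lowPass_of_lt {φ : ℝ → ℝ} {a : ℝ} (ha : 0 < a) (h1 : ∀ r, r < a → φ r = 0) {r : ℝ}
    (hr : r < a) : lowPass φ r = 1 := by
  rw [lowPass_eq_sum h1 (M := 0)]
  · simp
  · intro m _
    have hpos : (0 : ℝ) < (2 : ℝ) ^ (-((m : ℤ) + 1)) := by positivity
    have hle : (2 : ℝ) ^ (-((m : ℤ) + 1)) ≤ 1 := zpow_le_one_of_nonpos₀ one_le_two (by omega)
    rcases le_or_gt r 0 with h | h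
    · exact (mul_nonpos_of_nonneg_of_nonpos hpos.le h).trans_lt ha
    · exact (mul_le_of_le_one_left h.le hle).trans_lt hr

theorem lowPass_zero {φ : ℝ → ℝ} (hφ : IsLittlewoodPaley φ) : lowPass φ 0 = 1 := by
  obtain ⟨a, b, ha, -, h1, -⟩ := hφ.exists_bounds
  exact lowPass_of_lt ha h1 ha

/-- Beyond `b` the terms with `j ≤ 0` of the partition of unity vanish, so those with `j ≥ 1`
already add up to `1`. -/
theorem lowPass_of_gt {φ : ℝ → ℝ} (hφ : IsLittlewoodPaley φ) {b : ℝ} (hb : 0 < b)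
    (h2 : ∀ r, b < r → φ r = 0) {r : ℝ} (hr : b < r) : lowPass φ r = 0 := by
  have hr0 : 0 < r := hb.trans hr
  have hinj : Function.Injective fun m : ℕ => (m : ℤ) + 1 := fun m m' h => by
    simpa using h
  have h : HasSum ((fun j : ℤ => φ ((2 : ℝ) ^ (-j) * r)) ∘ fun m : ℕ => (m : ℤ) + 1) 1 := by
    refine (hinj.hasSum_iff fun j hj => ?_).2 (hφ.sum_eq_one r hr0)
    have hj0 : j ≤ 0 := by
      by_contra hcon
      exact hj ⟨(j - 1).toNat, by dsimp only; omega⟩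
    refine h2 _ (hr.trans_le ?_)
    exact le_mul_of_one_le_left hr0.le (one_le_zpow₀ one_le_two (by omega))
  have := h.tsum_eq
  simp only [Function.comp_def] at this
  rw [lowPass, this, sub_self]

theorem isRadialProfile_lowPass {φ : ℝ → ℝ} (hφ : IsLittlewoodPaley φ) :
    IsRadialProfile (lowPass φ) := by
  obtain ⟨a, b, ha, hb, h1, h2⟩ := hφ.exists_bounds
  refine ⟨?_, ⟨b, fun r hr => lowPass_of_gt hφ hb h2 hr⟩, ⟨a, ha, fun r hr => ?_⟩⟩
  · rw [contDiff_iff_contDiffAt]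
    intro r
    obtain ⟨M, hM⟩ := exists_pow_neg_mul_lt ha (r + 1)
    have heq : lowPass φ =ᶠ[nhds r] fun r =>
        1 - ∑ m ∈ Finset.range M, φ ((2 : ℝ) ^ (-((m : ℤ) + 1)) * r) := by
      filter_upwards [Iio_mem_nhds (lt_add_one r)] with r' hr'
      exact lowPass_eq_sum h1 fun m hm => hM m hm r' hr'
    refine ContDiffAt.congr_of_eventuallyEq ?_ heq
    refine ContDiff.contDiffAt ?_
    refine contDiff_const.sub (ContDiff.sum fun m _ => ?_)
    exact hφ.smooth.comp (contDiff_const.mul contDiff_id)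
  · rw [lowPass_of_lt ha h1 hr, lowPass_zero hφ]

theorem lowPass_sub {φ : ℝ → ℝ} (hφ : IsLittlewoodPaley φ) (r : ℝ) :
    lowPass φ r - lowPass φ (2 * r) = φ r := by
  obtain ⟨a, b, ha, hb, h1, h2⟩ := hφ.exists_bounds
  obtain ⟨M, hM⟩ := exists_pow_neg_mul_lt ha (max r (2 * r) + 1)
  -- Doubling `r` shifts the index by one. With truncations at `M` and `M + 1` the two sums differ
  -- by exactly the term `φ r`.
  rw [lowPass_eq_sum (r := r) h1 (M := M) fun m hm =>
      hM m hm r ((le_max_left _ _).trans_lt (lt_add_one _)),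
    lowPass_eq_sum (r := 2 * r) h1 (M := M + 1) fun m hm =>
      hM m (by omega) (2 * r) ((le_max_right _ _).trans_lt (lt_add_one _)),
    Finset.sum_range_succ']
  have e : ∀ m : ℕ, (2 : ℝ) ^ (-(((m + 1 : ℕ) : ℤ) + 1)) * (2 * r)
      = (2 : ℝ) ^ (-((m : ℤ) + 1)) * r := fun m => by
    rw [← mul_assoc, ← zpow_add_one₀ two_ne_zero]
    congr 2
  simp only [e]
  norm_num
  congr 1
  ring

theorem lpKernel_lowPass_sub {φ : ℝ → ℝ} (hφ : IsLittlewoodPaley φ) (k : ℤ) (x : E n) :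
    lpKernel (lowPass φ) k x - lpKernel (lowPass φ) (k - 1) x = lpKernel φ k x := by
  have hχ := isRadialProfile_lowPass hφ
  have hint : ∀ j : ℤ, Integrable (fun ξ : E n =>
      Complex.exp (((2 * Real.pi * inner ℝ ξ x : ℝ) : ℂ) * Complex.I) •
        symbol (lowPass φ) j ξ) := fun j => by
    refine (hχ.integrable_symbol j).bdd_mul (c := 1)
      (by fun_prop) (ae_of_all _ fun ξ => ?_)
    rw [Complex.norm_exp_ofReal_mul_I]
  rw [lpKernel_eq, lpKernel_eq, lpKernel_eq, Real.fourierInv_eq', Real.fourierInv_eq',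
    Real.fourierInv_eq', ← integral_sub (hint k) (hint (k - 1))]
  congr 1
  ext ξ
  rw [← smul_sub]
  congr 1
  rw [symbol, symbol, symbol, ← Complex.ofReal_sub, ← lowPass_sub hφ]
  congr 3
  rw [← mul_assoc 2 ((2 : ℝ) ^ (-k)), ← zpow_one_add₀ two_ne_zero]
  congr 3
  ring

theorem lpProj_lowPass_sub {φ : ℝ → ℝ} (hφ : IsLittlewoodPaley φ) (k : ℤ) {u : E n → ℂ}
    (hu : AEStronglyMeasurable u volume) (hm : decayMass (fun x => ‖u x‖ₑ) < ∞) (x : E n) :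
    lpProj (lowPass φ) k u x - lpProj (lowPass φ) (k - 1) u x = lpProj φ k u x := by
  have hχ := isRadialProfile_lowPass hφ
  rw [lpProj, lpProj, lpProj, ← integral_sub (hχ.integrable_kernel_mul k hu hm x)
    (hχ.integrable_kernel_mul (k - 1) hu hm x)]
  congr 1
  ext y
  rw [← sub_mul, lpKernel_lowPass_sub hφ]

/-! ### Frequency supports of products -/

namespace IsRadialProfile

variable {g : ℝ → ℝ} (hg : IsRadialProfile g)
include hg

/-- Plane waves are eigenfunctions of Fourier multipliers. -/
theorem integral_lpKernel_mul_exp (j : ℤ) (x η : E n) :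
    ∫ y, lpKernel g j (x - y) * Complex.exp (((2 * Real.pi * inner ℝ η y : ℝ) : ℂ) * Complex.I) =
      symbol g j η * Complex.exp (((2 * Real.pi * inner ℝ η x : ℝ) : ℂ) * Complex.I) := by
  have h := congrFun (hg.fourier_lpKernel (n := n) j) η
  rw [Real.fourier_eq'] at h
  rw [← h, ← integral_mul_const, ← integral_sub_left_eq_self _ volume x]
  congr 1
  ext y
  rw [sub_sub_cancel, smul_eq_mul, mul_comm (Complex.exp _) (lpKernel g j y),
    mul_assoc (lpKernel g j y), ← Complex.exp_add, inner_sub_right, real_inner_comm y η]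
  congr 2
  push_cast
  ring

omit hg in
theorem lpKernel_apply (j : ℤ) (x : E n) : lpKernel g j x = ∫ η, symbol g j η *
    Complex.exp (((2 * Real.pi * inner ℝ η x : ℝ) : ℂ) * Complex.I) := by
  rw [lpKernel_eq, Real.fourierInv_eq']
  simp only [smul_eq_mul, mul_comm]

/-- Qualitative, with no uniformity in `j`: a Schwartz kernel absorbs any polynomial growth. It
serves to justify Fubini's theorem and the splitting of integrals. -/
theorem lintegral_kernel_mul_pow_lt_top (j : ℤ) (k : ℕ) {F : E n → ℝ≥0∞} (hF : decayMass F < ∞)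
    (x : E n) :
    ∫⁻ y, ‖lpKernel g j (x - y)‖ₑ * (ENNReal.ofReal ((1 + ‖y‖) ^ k) * F y) < ∞ := by
  obtain ⟨K, hK⟩ := hg.exists_schwartz_lpKernel (n := n) j
  obtain ⟨C, hC0, hC⟩ := exists_one_add_norm_pow_mul_le K (k + (n + 1))
  have h : ∀ y, ‖lpKernel g j (x - y)‖ₑ * ENNReal.ofReal ((1 + ‖y‖) ^ k) ≤
      ENNReal.ofReal (C * (1 + ‖x‖) ^ (k + (n + 1))) * decay 1 1 y := fun y => by
    rw [← ofReal_norm, decay, ← ENNReal.ofReal_mul (by positivity),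
      ← ENNReal.ofReal_mul (by positivity), ← hK]
    refine ENNReal.ofReal_le_ofReal ?_
    simp only [one_pow, one_mul]
    rw [mul_one_div, le_div_iff₀ (by positivity)]
    have h1 : 1 + ‖y‖ ≤ (1 + ‖x‖) * (1 + ‖x - y‖) := by
      have h2 : ‖y‖ ≤ ‖x‖ + ‖x - y‖ := by
        have := norm_sub_le x (x - y)
        rwa [sub_sub_cancel] at this
      nlinarith [norm_nonneg x, norm_nonneg (x - y)]
    calc _ = (1 + ‖y‖) ^ (k + (n + 1)) * ‖K (x - y)‖ := by ring
      _ ≤ ((1 + ‖x‖) * (1 + ‖x - y‖)) ^ (k + (n + 1)) * ‖K (x - y)‖ := by gcongr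
      _ = ((1 + ‖x - y‖) ^ (k + (n + 1)) * ‖K (x - y)‖) * (1 + ‖x‖) ^ (k + (n + 1)) := by
        rw [mul_pow]
        ring
      _ ≤ _ := by
        gcongr
        exact hC _
  calc _ ≤ ∫⁻ y, ENNReal.ofReal (C * (1 + ‖x‖) ^ (k + (n + 1))) * (decay 1 1 y * F y) := by
        refine lintegral_mono fun y => ?_
        rw [← mul_assoc, ← mul_assoc]
        exact mul_le_mul_left (h y) _
    _ < ∞ := by
        rw [lintegral_const_mul' _ _ ENNReal.ofReal_ne_top]
        exact ENNReal.mul_lt_top ENNReal.ofReal_lt_top hF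

theorem lintegral_kernel_mul_le_pow (j : ℤ) {f : E n → ℝ≥0∞} (hm : decayMass f < ∞) :
    ∃ C : ℝ≥0, ∀ x, ∫⁻ y, ‖lpKernel g j (x - y)‖ₑ * f y ≤
      C * ENNReal.ofReal ((1 + ‖x‖) ^ (n + 1)) := by
  obtain ⟨C, hC⟩ := hg.lintegral_lpKernel_mul_le (n := n) 1
  have hpos : (0 : ℝ) < (2 : ℝ) ^ j := by positivity
  set A : ℝ≥0∞ := C * (ENNReal.ofReal (((2 : ℝ) ^ j) ^ n * (1 + ((2 : ℝ) ^ j)⁻¹) ^ (n + 1)) *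
    decayMass f) with hA
  have hAt : A ≠ ∞ := by finiteness
  refine ⟨A.toNNReal, fun x => ?_⟩
  rw [ENNReal.coe_toNNReal hAt]
  refine (hC j f x).trans ((mul_le_mul_right (decayAvg_le hpos _ x) _).trans_eq ?_)
  rw [hA]
  ring

theorem exists_enorm_lpProj_le_pow (j : ℤ) {f : E n → ℂ} (hm : decayMass (fun y => ‖f y‖ₑ) < ∞) :
    ∃ C : ℝ≥0, ∀ x, ‖lpProj g j f x‖ₑ ≤ C * ENNReal.ofReal ((1 + ‖x‖) ^ (n + 1)) := by
  obtain ⟨C, hC⟩ := hg.lintegral_kernel_mul_le_pow j hm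
  refine ⟨C, fun x => (enorm_integral_le_lintegral_enorm _).trans ?_⟩
  simp only [enorm_mul]
  exact hC x

end IsRadialProfile

/-- Fourier inversion writes the two kernels of `h` as superpositions of plane waves. A product of
waves of frequencies `η` and `ζ` has frequency `η + ζ`, on which `g(2⁻ʲ D)` acts as multiplication
by its symbol, and the support hypothesis makes the integrand vanish. Working with kernels keeps all
integrals absolutely convergent and avoids convolving distributions. -/
theorem integral_kernel_mul_kernel_mul_kernel {g h : ℝ → ℝ} (hg : IsRadialProfile g)
    (hh : IsRadialProfile h) {j J : ℤ}
    (hsupp : ∀ η ζ : E n, symbol g j (η + ζ) * (symbol h J η * symbol h J ζ) = 0) (x a b : E n) :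
    ∫ y, lpKernel g j (x - y) * (lpKernel h J (y - a) * lpKernel h J (y - b)) = 0 := by
  set e : E n → E n → ℂ := fun η x => Complex.exp (((2 * Real.pi * inner ℝ η x : ℝ) : ℂ) *
    Complex.I) with he
  have hadd : ∀ η x y, e η (x - y) = e η (-y) * e η x := fun η x y => by
    simp only [he]
    rw [← Complex.exp_add, sub_eq_neg_add, inner_add_right]
    congr 1
    push_cast
    ring
  have hadd' : ∀ η ζ x, e η x * e ζ x = e (η + ζ) x := fun η ζ x => by
    simp only [he]
    rw [← Complex.exp_add, inner_add_left]
    congr 1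
    push_cast
    ring
  have h1 : ∀ y, lpKernel g j (x - y) * (lpKernel h J (y - a) * lpKernel h J (y - b))
      = ∫ p : E n × E n, lpKernel g j (x - y) *
        ((symbol h J p.1 * e p.1 (y - a)) * (symbol h J p.2 * e p.2 (y - b))) := fun y => by
    rw [integral_const_mul, IsRadialProfile.lpKernel_apply, IsRadialProfile.lpKernel_apply (g := h),
      IsRadialProfile.lpKernel_apply (g := h)]
    congr 1
    exact (integral_prod_mul _ _).symm
  simp only [h1]
  rw [integral_integral_swap]
  · refine integral_eq_zero_of_ae (ae_of_all _ fun p => ?_)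
    have h2 : ∀ y, lpKernel g j (x - y) *
        ((symbol h J p.1 * e p.1 (y - a)) * (symbol h J p.2 * e p.2 (y - b)))
        = (symbol h J p.1 * symbol h J p.2 * e p.1 (-a) * e p.2 (-b)) *
          (lpKernel g j (x - y) * e (p.1 + p.2) y) := fun y => by
      rw [hadd, hadd p.2, ← hadd']
      ring
    simp only [h2]
    rw [integral_const_mul, hg.integral_lpKernel_mul_exp]
    have := hsupp p.1 p.2
    simp only [Pi.zero_apply]
    linear_combination (e p.1 (-a) * e p.2 (-b) * e (p.1 + p.2) x) * this
  · have hi1 : Integrable (fun y : E n => lpKernel g j (x - y)) :=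
      (hg.integrable_lpKernel j).comp_sub_left x
    have hi2 : Integrable (fun p : E n × E n => symbol h J p.1 * symbol h J p.2)
        (volume.prod volume) := (hh.integrable_symbol J).mul_prod (hh.integrable_symbol J)
    have hi3 := (hi1.mul_prod hi2).bdd_mul (c := 1)
      (f := fun z : E n × (E n × E n) => e z.2.1 (z.1 - a) * e z.2.2 (z.1 - b)) ?_
      (ae_of_all _ fun z => ?_)
    · refine hi3.congr (ae_of_all _ fun z => ?_)
      simp only [Function.uncurry]
      ring
    · refine Continuous.aestronglyMeasurable ?_
      simp only [he]
      fun_prop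
    · simp only [he]
      rw [norm_mul, Complex.norm_exp_ofReal_mul_I, Complex.norm_exp_ofReal_mul_I, one_mul]

/-- If the sumset of the frequency support of `h(2⁻ᴶ D)` with itself does not meet that of
`g(2⁻ʲ D)`, then `g(2⁻ʲ D)` annihilates `h(2⁻ᴶ D) u · h(2⁻ᴶ D) v`. -/
theorem lpProj_mul_lpProj_eq_zero {g h : ℝ → ℝ} (hg : IsRadialProfile g)
    (hh : IsRadialProfile h) {j J : ℤ}
    (hsupp : ∀ η ζ : E n, symbol g j (η + ζ) * (symbol h J η * symbol h J ζ) = 0)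
    {u v : E n → ℂ} (hu : AEStronglyMeasurable u volume) (hv : AEStronglyMeasurable v volume)
    (hum : decayMass (fun x => ‖u x‖ₑ) < ∞) (hvm : decayMass (fun x => ‖v x‖ₑ) < ∞) (x : E n) :
    lpProj g j (fun y => lpProj h J u y * lpProj h J v y) x = 0 := by
  have h1 : ∀ y, lpKernel g j (x - y) * (lpProj h J u y * lpProj h J v y)
      = ∫ p : E n × E n, lpKernel g j (x - y) *
        ((lpKernel h J (y - p.1) * u p.1) * (lpKernel h J (y - p.2) * v p.2)) := fun y => by
    rw [integral_const_mul, lpProj, lpProj]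
    congr 1
    exact (integral_prod_mul _ _).symm
  rw [lpProj]
  simp only [h1]
  rw [integral_integral_swap]
  · refine integral_eq_zero_of_ae (ae_of_all _ fun p => ?_)
    have h2 : ∀ y, lpKernel g j (x - y) *
        ((lpKernel h J (y - p.1) * u p.1) * (lpKernel h J (y - p.2) * v p.2))
        = (u p.1 * v p.2) *
          (lpKernel g j (x - y) * (lpKernel h J (y - p.1) * lpKernel h J (y - p.2))) :=
      fun y => by ring
    simp only [h2]
    rw [integral_const_mul, integral_kernel_mul_kernel_mul_kernel hg hh hsupp, mul_zero]
    rfl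
  · have hmeas : AEStronglyMeasurable (Function.uncurry fun (y : E n) (p : E n × E n) =>
        lpKernel g j (x - y) *
          ((lpKernel h J (y - p.1) * u p.1) * (lpKernel h J (y - p.2) * v p.2)))
        ((volume : Measure (E n)).prod (volume : Measure (E n × E n))) := by
      have c1 : Continuous (fun z : E n × (E n × E n) => lpKernel g j (x - z.1)) :=
        (hg.continuous_lpKernel j).comp (by fun_prop)
      have c2 : Continuous (fun z : E n × (E n × E n) => lpKernel h J (z.1 - z.2.1)) :=
        (hh.continuous_lpKernel J).comp (by fun_prop)
      have c3 : Continuous (fun z : E n × (E n × E n) => lpKernel h J (z.1 - z.2.2)) :=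
        (hh.continuous_lpKernel J).comp (by fun_prop)
      have m1 : AEStronglyMeasurable (fun z : E n × (E n × E n) => u z.2.1)
          ((volume : Measure (E n)).prod (volume : Measure (E n × E n))) :=
        (hu.comp_quasiMeasurePreserving Measure.quasiMeasurePreserving_fst).comp_quasiMeasurePreserving
          Measure.quasiMeasurePreserving_snd
      have m2 : AEStronglyMeasurable (fun z : E n × (E n × E n) => v z.2.2)
          ((volume : Measure (E n)).prod (volume : Measure (E n × E n))) :=
        (hv.comp_quasiMeasurePreserving Measure.quasiMeasurePreserving_snd).comp_quasiMeasurePreserving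
          Measure.quasiMeasurePreserving_snd
      exact c1.aestronglyMeasurable.mul
        ((c2.aestronglyMeasurable.mul m1).mul (c3.aestronglyMeasurable.mul m2))
    refine ⟨hmeas, ?_⟩
    -- Fubini's theorem applies because the inner integrals of absolute values grow at most
    -- polynomially in `y`, and the outer kernel is Schwartz.
    obtain ⟨A, hA⟩ := hh.lintegral_kernel_mul_le_pow J hum
    obtain ⟨B, hB⟩ := hh.lintegral_kernel_mul_le_pow J hvm
    rw [HasFiniteIntegral, lintegral_prod _ hmeas.enorm]
    have h3 : ∀ y, ∫⁻ p : E n × E n, ‖lpKernel g j (x - y) *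
        ((lpKernel h J (y - p.1) * u p.1) * (lpKernel h J (y - p.2) * v p.2))‖ₑ
          ≤ ‖lpKernel g j (x - y)‖ₑ *
        (ENNReal.ofReal ((1 + ‖y‖) ^ (2 * (n + 1))) * ((A * B : ℝ≥0) : ℝ≥0∞)) := fun y => by
      simp only [enorm_mul]
      rw [lintegral_const_mul' _ _ enorm_ne_top]
      gcongr
      have mu : AEMeasurable (fun a => ‖lpKernel h J (y - a)‖ₑ * ‖u a‖ₑ) volume := by
        simpa only [enorm_mul] using (hh.aestronglyMeasurable_kernel_mul J hu y).enorm
      have mv : AEMeasurable (fun a => ‖lpKernel h J (y - a)‖ₑ * ‖v a‖ₑ) volume := by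
        simpa only [enorm_mul] using (hh.aestronglyMeasurable_kernel_mul J hv y).enorm
      rw [Measure.volume_eq_prod, lintegral_prod_mul mu mv]
      refine (mul_le_mul' (hA y) (hB y)).trans_eq ?_
      rw [two_mul, pow_add _ (n + 1) (n + 1), ENNReal.ofReal_mul (by positivity), ENNReal.coe_mul]
      ring
    exact (lintegral_mono h3).trans_lt (hg.lintegral_kernel_mul_pow_lt_top j _
      (decayMass_const_lt_top ENNReal.coe_ne_top) x)


/-! ### The paraproduct estimate -/

/-- A majorant of `u v - S_J u S_J v`, obtained by telescoping the low-frequency cut-offs `S_k`. -/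
noncomputable def paraproductMajorant (φ : ℝ → ℝ) (J : ℤ) (u v : E n → ℂ) (x : E n) : ℝ≥0∞ :=
  ∑' m : ℕ, (‖lpProj φ (J + m + 1) u x‖ₑ * ‖lpProj (lowPass φ) (J + m + 1) v x‖ₑ +
    ‖lpProj (lowPass φ) (J + m) u x‖ₑ * ‖lpProj φ (J + m + 1) v x‖ₑ)

theorem IsLittlewoodPaley.exists_frequency_gap {φ : ℝ → ℝ} (hφ : IsLittlewoodPaley φ) :
    ∃ N : ℕ, ∀ (j : ℤ) (η ζ : E n), symbol φ j (η + ζ) *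
      (symbol (lowPass φ) (j - N) η * symbol (lowPass φ) (j - N) ζ) = 0 := by
  obtain ⟨a, b, ha, hb, h1, h2⟩ := hφ.exists_bounds
  -- After rescaling by `2^{-j}`, two frequencies passed by the cut-off have size at most `b 2^{-N}`
  -- each; their sum is below the lower edge `a` of the annulus once `2^N > 2b / a`.
  obtain ⟨N, hN⟩ := pow_unbounded_of_one_lt (2 * b / a) (one_lt_two (α := ℝ))
  rw [div_lt_iff₀ ha] at hN
  refine ⟨N, fun j η ζ => ?_⟩
  by_contra hcon
  simp only [mul_eq_zero, not_or, symbol, Complex.ofReal_eq_zero] at hcon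
  have hs : ∀ ξ : E n, lowPass φ ((2 : ℝ) ^ (-(j - (N : ℤ))) * (2 * Real.pi * ‖ξ‖)) ≠ 0 →
      2 ^ N * ((2 : ℝ) ^ (-j) * (2 * Real.pi * ‖ξ‖)) ≤ b := fun ξ hξ => by
    by_contra hb'
    refine hξ (lowPass_of_gt hφ hb h2 ?_)
    have : (2 : ℝ) ^ (-(j - (N : ℤ))) = 2 ^ N * (2 : ℝ) ^ (-j) := by
      rw [neg_sub, sub_eq_add_neg, zpow_add₀ two_ne_zero, zpow_natCast]
    rw [this, mul_assoc]
    exact not_le.1 hb'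
  have e1 := hs η hcon.2.1
  have e2 := hs ζ hcon.2.2
  have e3 : a ≤ (2 : ℝ) ^ (-j) * (2 * Real.pi * ‖η + ζ‖) := by
    by_contra hlt
    exact hcon.1 (h1 _ (not_le.1 hlt))
  have e4 : (2 : ℝ) ^ (-j) * (2 * Real.pi * ‖η + ζ‖) ≤
      (2 : ℝ) ^ (-j) * (2 * Real.pi * ‖η‖) + (2 : ℝ) ^ (-j) * (2 * Real.pi * ‖ζ‖) := by
    rw [← mul_add, ← mul_add]
    gcongr
    exact norm_add_le _ _
  have e5 : 2 ^ N * a ≤ 2 ^ N * ((2 : ℝ) ^ (-j) * (2 * Real.pi * ‖η‖) +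
      (2 : ℝ) ^ (-j) * (2 * Real.pi * ‖ζ‖)) := by
    gcongr
    exact e3.trans e4
  rw [mul_add] at e5
  linarith

theorem tendsto_add_natCast {X : Type*} {l : Filter X} {f : ℤ → X} (J : ℤ)
    (h : Filter.Tendsto (fun k : ℕ => f k) Filter.atTop l) :
    Filter.Tendsto (fun M : ℕ => f (J + M)) Filter.atTop l := by
  have h1 : Filter.Tendsto (fun M : ℕ => (J + M).toNat) Filter.atTop Filter.atTop := by
    refine Filter.tendsto_atTop.2 fun b => ?_
    filter_upwards [Filter.eventually_ge_atTop (b + J.natAbs)] with M hM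
    omega
  refine (h.comp h1).congr' ?_
  filter_upwards [Filter.eventually_ge_atTop J.natAbs] with M hM
  simp only [Function.comp_apply]
  congr 1
  omega

/-- The product is telescoped from level `J` to `J + M`, and `M → ∞` is taken at points where both
cut-offs converge. -/
theorem enorm_mul_sub_le_paraproductMajorant {φ : ℝ → ℝ} (hφ : IsLittlewoodPaley φ)
    {u v : E n → ℂ} (hu : AEStronglyMeasurable u volume) (hv : AEStronglyMeasurable v volume)
    (hum : decayMass (fun x => ‖u x‖ₑ) < ∞) (hvm : decayMass (fun x => ‖v x‖ₑ) < ∞) (J : ℤ) :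
    ∀ᵐ x, ‖u x * v x - lpProj (lowPass φ) J u x * lpProj (lowPass φ) J v x‖ₑ ≤
      paraproductMajorant φ J u v x := by
  have hχ := isRadialProfile_lowPass hφ
  filter_upwards [hχ.ae_tendsto_lpProj (lowPass_zero hφ) hu hum,
    hχ.ae_tendsto_lpProj (lowPass_zero hφ) hv hvm] with x hxu hxv
  set S : ℤ → ℂ := fun k => lpProj (lowPass φ) k u x with hS
  set T : ℤ → ℂ := fun k => lpProj (lowPass φ) k v x with hT
  have hfin : ∀ M : ℕ, ‖S (J + M) * T (J + M) - S J * T J‖ₑ ≤ ∑ m ∈ Finset.range M,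
      (‖lpProj φ (J + m + 1) u x‖ₑ * ‖T (J + m + 1)‖ₑ +
        ‖S (J + m)‖ₑ * ‖lpProj φ (J + m + 1) v x‖ₑ) := by
    intro M
    induction M with
    | zero => simp
    | succ M ih =>
      rw [Finset.sum_range_succ]
      have e1 := lpProj_lowPass_sub hφ (J + M + 1) hu hum x
      have e2 := lpProj_lowPass_sub hφ (J + M + 1) hv hvm x
      rw [add_sub_cancel_right] at e1 e2
      rw [← e1, ← e2]
      have e3 : S (J + (M + 1 : ℕ)) * T (J + (M + 1 : ℕ)) - S J * T J =
          (S (J + M) * T (J + M) - S J * T J) +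
            ((S (J + M + 1) - S (J + M)) * T (J + M + 1) +
              S (J + M) * (T (J + M + 1) - T (J + M))) := by
        push_cast
        rw [← add_assoc J]
        ring
      rw [e3]
      refine (enorm_add_le _ _).trans (add_le_add ih ((enorm_add_le _ _).trans_eq ?_))
      rw [enorm_mul, enorm_mul]
  have hlim : Filter.Tendsto (fun M : ℕ => ‖S (J + M) * T (J + M) - S J * T J‖ₑ) Filter.atTop
      (nhds ‖u x * v x - S J * T J‖ₑ) :=
    (continuous_enorm.tendsto _).comp
      (((tendsto_add_natCast J hxu).mul (tendsto_add_natCast J hxv)).sub tendsto_const_nhds)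
  exact le_of_tendsto' hlim fun M => (hfin M).trans (ENNReal.sum_le_tsum _)

/-- The sum which bounds the weighted norm of `P_j (u v)`, for functions of space only. -/
noncomputable def paraproductBound (φ : ℝ → ℝ) (q₁ q₂ p₁ p₂ : ℝ≥0∞) (W₁ W₂ Z₁ Z₂ : E n → ℝ≥0∞)
    (J : ℤ) (u v : E n → ℂ) : ℝ≥0∞ :=
  ∑' m : ℕ, (eLpNorm (fun x => W₁ x * ‖lpProj φ (J + m + 1) u x‖ₑ) q₁ volume *
      eLpNorm (fun x => Z₁ x * ‖v x‖ₑ) p₁ volume +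
    eLpNorm (fun x => W₂ x * ‖lpProj φ (J + m + 1) v x‖ₑ) q₂ volume *
      eLpNorm (fun x => Z₂ x * ‖u x‖ₑ) p₂ volume)

/-- In each term the weight is split so that the dyadic piece keeps `W₁` or `W₂`, while the cut-off
factor receives `Z₁` or `Z₂` and is bounded there uniformly in its frequency. -/
theorem eLpNorm_paraproductMajorant_le {φ : ℝ → ℝ} (hφ : IsLittlewoodPaley φ)
    {q₀ q₁ q₂ p₁ p₂ : ℝ≥0∞} (hq₀ : 1 ≤ q₀)
    (hqp₁ : q₀⁻¹ = q₁⁻¹ + p₁⁻¹) (hqp₂ : q₀⁻¹ = q₂⁻¹ + p₂⁻¹)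
    {W₀ W₁ W₂ Z₁ Z₂ : E n → ℝ≥0∞} (hW₀ : AEMeasurable W₀ volume)
    (hW₁ : AEMeasurable W₁ volume) (hW₂ : AEMeasurable W₂ volume)
    (hZ₁ : AEMeasurable Z₁ volume) (hZ₂ : AEMeasurable Z₂ volume)
    (h₁ : ∀ᵐ x, W₀ x = W₁ x * Z₁ x) (h₂ : ∀ᵐ x, W₀ x = W₂ x * Z₂ x)
    (hB₁ : DecayBound p₁ Z₁) (hB₂ : DecayBound p₂ Z₂) :
    ∃ C : ℝ≥0, ∀ u v : E n → ℂ, AEStronglyMeasurable u volume → AEStronglyMeasurable v volume →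
      ∀ J : ℤ, eLpNorm (fun x => W₀ x * paraproductMajorant φ J u v x) q₀ volume ≤
        C * paraproductBound φ q₁ q₂ p₁ p₂ W₁ W₂ Z₁ Z₂ J u v := by
  have hχ := isRadialProfile_lowPass hφ
  have hφ' := hφ.isRadialProfile
  obtain ⟨C₁, hC₁⟩ := hχ.lpProj_weighted_bound hB₁
  obtain ⟨C₂, hC₂⟩ := hχ.lpProj_weighted_bound hB₂
  have hq0 : q₀ ≠ 0 := (one_pos.trans_le hq₀).ne'
  refine ⟨max C₁ C₂, fun u v hu hv J => ?_⟩
  have mφ : ∀ (k : ℤ) {f : E n → ℂ}, AEStronglyMeasurable f volume →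
      AEMeasurable (fun x => ‖lpProj φ k f x‖ₑ) volume :=
    fun k f hf => (hφ'.aestronglyMeasurable_lpProj k hf).enorm
  have mχ : ∀ (k : ℤ) {f : E n → ℂ}, AEStronglyMeasurable f volume →
      AEMeasurable (fun x => ‖lpProj (lowPass φ) k f x‖ₑ) volume :=
    fun k f hf => (hχ.aestronglyMeasurable_lpProj k hf).enorm
  have m1 : ∀ m : ℕ, AEMeasurable (fun x => W₀ x * (‖lpProj φ (J + m + 1) u x‖ₑ *
      ‖lpProj (lowPass φ) (J + m + 1) v x‖ₑ)) volume := fun m =>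
    hW₀.mul ((mφ _ hu).mul (mχ _ hv))
  have m2 : ∀ m : ℕ, AEMeasurable (fun x => W₀ x * (‖lpProj (lowPass φ) (J + m) u x‖ₑ *
      ‖lpProj φ (J + m + 1) v x‖ₑ)) volume := fun m =>
    hW₀.mul ((mχ _ hu).mul (mφ _ hv))
  have b1 : ∀ m : ℕ, eLpNorm (fun x => W₀ x * (‖lpProj φ (J + m + 1) u x‖ₑ *
      ‖lpProj (lowPass φ) (J + m + 1) v x‖ₑ)) q₀ volume ≤
      (max C₁ C₂ : ℝ≥0) * (eLpNorm (fun x => W₁ x * ‖lpProj φ (J + m + 1) u x‖ₑ) q₁ volume *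
        eLpNorm (fun x => Z₁ x * ‖v x‖ₑ) p₁ volume) := fun m => by
    calc _ = eLpNorm (fun x => (W₁ x * ‖lpProj φ (J + m + 1) u x‖ₑ) *
          (Z₁ x * ‖lpProj (lowPass φ) (J + m + 1) v x‖ₑ)) q₀ volume := by
          refine eLpNorm_congr_ae ?_
          filter_upwards [h₁] with x hx
          rw [hx]
          ring
      _ ≤ eLpNorm (fun x => W₁ x * ‖lpProj φ (J + m + 1) u x‖ₑ) q₁ volume *
          eLpNorm (fun x => Z₁ x * ‖lpProj (lowPass φ) (J + m + 1) v x‖ₑ) p₁ volume :=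
          eLpNorm_mul_le hqp₁ hq0 (hW₁.mul (mφ _ hu)) (hZ₁.mul (mχ _ hv))
      _ ≤ eLpNorm (fun x => W₁ x * ‖lpProj φ (J + m + 1) u x‖ₑ) q₁ volume *
          (C₁ * eLpNorm (fun x => Z₁ x * ‖v x‖ₑ) p₁ volume) := by
          gcongr
          exact hC₁ _ v hv
      _ = C₁ * (eLpNorm (fun x => W₁ x * ‖lpProj φ (J + m + 1) u x‖ₑ) q₁ volume *
          eLpNorm (fun x => Z₁ x * ‖v x‖ₑ) p₁ volume) := by ring
      _ ≤ _ := by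
          gcongr
          exact le_max_left _ _
  have b2 : ∀ m : ℕ, eLpNorm (fun x => W₀ x * (‖lpProj (lowPass φ) (J + m) u x‖ₑ *
      ‖lpProj φ (J + m + 1) v x‖ₑ)) q₀ volume ≤
      (max C₁ C₂ : ℝ≥0) * (eLpNorm (fun x => W₂ x * ‖lpProj φ (J + m + 1) v x‖ₑ) q₂ volume *
        eLpNorm (fun x => Z₂ x * ‖u x‖ₑ) p₂ volume) := fun m => by
    calc _ = eLpNorm (fun x => (W₂ x * ‖lpProj φ (J + m + 1) v x‖ₑ) *
          (Z₂ x * ‖lpProj (lowPass φ) (J + m) u x‖ₑ)) q₀ volume := by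
          refine eLpNorm_congr_ae ?_
          filter_upwards [h₂] with x hx
          rw [hx]
          ring
      _ ≤ eLpNorm (fun x => W₂ x * ‖lpProj φ (J + m + 1) v x‖ₑ) q₂ volume *
          eLpNorm (fun x => Z₂ x * ‖lpProj (lowPass φ) (J + m) u x‖ₑ) p₂ volume :=
          eLpNorm_mul_le hqp₂ hq0 (hW₂.mul (mφ _ hv)) (hZ₂.mul (mχ _ hu))
      _ ≤ eLpNorm (fun x => W₂ x * ‖lpProj φ (J + m + 1) v x‖ₑ) q₂ volume *
          (C₂ * eLpNorm (fun x => Z₂ x * ‖u x‖ₑ) p₂ volume) := by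
          gcongr
          exact hC₂ _ u hu
      _ = C₂ * (eLpNorm (fun x => W₂ x * ‖lpProj φ (J + m + 1) v x‖ₑ) q₂ volume *
          eLpNorm (fun x => Z₂ x * ‖u x‖ₑ) p₂ volume) := by ring
      _ ≤ _ := by
          gcongr
          exact le_max_right _ _
  simp only [paraproductMajorant, ← ENNReal.tsum_mul_left, mul_add]
  refine (eLpNorm_tsum_le hq₀ fun m => (m1 m).add (m2 m)).trans ?_
  rw [paraproductBound, ← ENNReal.tsum_mul_left]
  refine ENNReal.tsum_le_tsum fun m => ?_
  refine (eLpNorm_add_le_ennreal hq₀ (m1 m) (m2 m)).trans ?_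
  rw [mul_add]
  exact add_le_add (b1 m) (b2 m)

theorem aemeasurable_paraproductMajorant {φ : ℝ → ℝ} (hφ : IsLittlewoodPaley φ)
    {u v : E n → ℂ} (hu : AEStronglyMeasurable u volume) (hv : AEStronglyMeasurable v volume)
    (J : ℤ) : AEMeasurable (paraproductMajorant φ J u v) volume := by
  have hχ := isRadialProfile_lowPass hφ
  have hφ' := hφ.isRadialProfile
  refine AEMeasurable.tsum fun m => ?_
  exact ((hφ'.aestronglyMeasurable_lpProj _ hu).enorm.mul
    (hχ.aestronglyMeasurable_lpProj _ hv).enorm).add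
    ((hχ.aestronglyMeasurable_lpProj _ hu).enorm.mul (hφ'.aestronglyMeasurable_lpProj _ hv).enorm)

theorem enorm_lowPass_mul_le {φ : ℝ → ℝ} (hφ : IsLittlewoodPaley φ) {u v : E n → ℂ}
    (hum : decayMass (fun x => ‖u x‖ₑ) < ∞) (hvm : decayMass (fun x => ‖v x‖ₑ) < ∞) (J : ℤ) :
    ∃ C : ℝ≥0, ∀ x, ‖lpProj (lowPass φ) J u x * lpProj (lowPass φ) J v x‖ₑ ≤
      ENNReal.ofReal ((1 + ‖x‖) ^ (2 * (n + 1))) * C := by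
  have hχ := isRadialProfile_lowPass hφ
  obtain ⟨A, hA⟩ := hχ.exists_enorm_lpProj_le_pow J hum
  obtain ⟨B, hB⟩ := hχ.exists_enorm_lpProj_le_pow J hvm
  refine ⟨A * B, fun x => ?_⟩
  rw [enorm_mul]
  refine (mul_le_mul' (hA x) (hB x)).trans_eq ?_
  rw [two_mul, pow_add _ (n + 1) (n + 1), ENNReal.ofReal_mul (by positivity), ENNReal.coe_mul]
  ring

/-- The product is a low-frequency part of polynomial growth plus a remainder below the majorant; a
single level `J` suffices. -/
theorem isTempered_mul {φ : ℝ → ℝ} (hφ : IsLittlewoodPaley φ)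
    {u v : E n → ℂ} (hu : AEStronglyMeasurable u volume) (hv : AEStronglyMeasurable v volume)
    (hum : decayMass (fun x => ‖u x‖ₑ) < ∞) (hvm : decayMass (fun x => ‖v x‖ₑ) < ∞) {J : ℤ}
    (hH : decayMass (paraproductMajorant φ J u v) < ∞) :
    IsTempered (fun x => u x * v x) := by
  obtain ⟨C, hC⟩ := enorm_lowPass_mul_le hφ hum hvm J
  refine isTempered_of_le (hu.mul hv) (F := fun x => C + paraproductMajorant φ J u v x)
    (2 * (n + 1)) ?_ ?_
  · rw [decayMass_add aemeasurable_const]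
    exact ENNReal.add_lt_top.2 ⟨decayMass_const_lt_top ENNReal.coe_ne_top, hH⟩
  · filter_upwards [enorm_mul_sub_le_paraproductMajorant hφ hu hv hum hvm J] with x hx
    calc ‖u x * v x‖ₑ
        = ‖lpProj (lowPass φ) J u x * lpProj (lowPass φ) J v x +
          (u x * v x - lpProj (lowPass φ) J u x * lpProj (lowPass φ) J v x)‖ₑ := by
          rw [add_sub_cancel]
      _ ≤ ENNReal.ofReal ((1 + ‖x‖) ^ (2 * (n + 1))) * C + paraproductMajorant φ J u v x :=
          (enorm_add_le _ _).trans (add_le_add (hC x) hx)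
      _ ≤ _ := by
          rw [mul_add (ENNReal.ofReal _)]
          gcongr
          refine le_mul_of_one_le_left zero_le ?_
          rw [ENNReal.one_le_ofReal]
          exact one_le_pow₀ (by linarith [norm_nonneg x])

/-- By the frequency gap, `P_j` does not see the product of the cut-offs at level `j - N`, so only
the remainder is convolved. Finiteness of the majorant's mass allows the integral to be split. -/
theorem enorm_lpProj_mul_le {φ : ℝ → ℝ} (hφ : IsLittlewoodPaley φ) :
    ∃ (N : ℕ) (C : ℝ≥0), ∀ u v : E n → ℂ, AEStronglyMeasurable u volume →
      AEStronglyMeasurable v volume → decayMass (fun x => ‖u x‖ₑ) < ∞ →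
      decayMass (fun x => ‖v x‖ₑ) < ∞ → ∀ j : ℤ,
      decayMass (paraproductMajorant φ (j - N) u v) < ∞ → ∀ x,
      ‖lpProj φ j (fun y => u y * v y) x‖ₑ ≤
        C * decayAvg 1 ((2 : ℝ) ^ j) (paraproductMajorant φ (j - N) u v) x := by
  have hχ := isRadialProfile_lowPass hφ
  have hφ' := hφ.isRadialProfile
  obtain ⟨N, hN⟩ := hφ.exists_frequency_gap (n := n)
  obtain ⟨C, hC⟩ := hφ'.lintegral_lpKernel_mul_le (n := n) 1
  refine ⟨N, C, fun u v hu hv hum hvm j hH x => ?_⟩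
  set F : E n → ℂ := fun y => lpProj (lowPass φ) (j - N) u y * lpProj (lowPass φ) (j - N) v y
    with hF
  have hle := enorm_mul_sub_le_paraproductMajorant hφ hu hv hum hvm (j - N)
  have hFm : AEStronglyMeasurable F volume :=
    (hχ.aestronglyMeasurable_lpProj _ hu).mul (hχ.aestronglyMeasurable_lpProj _ hv)
  have hbound : ∫⁻ y, ‖lpKernel φ j (x - y) * (u y * v y - F y)‖ₑ ≤
      ∫⁻ y, ‖lpKernel φ j (x - y)‖ₑ * paraproductMajorant φ (j - N) u v y := by
    refine lintegral_mono_ae ?_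
    filter_upwards [hle] with y hy
    rw [enorm_mul]
    exact mul_le_mul_right hy _
  have hi1 : Integrable (fun y => lpKernel φ j (x - y) * (u y * v y - F y)) :=
    ⟨hφ'.aestronglyMeasurable_kernel_mul j ((hu.mul hv).sub hFm) x,
      hbound.trans_lt (hφ'.lintegral_enorm_kernel_lt_top j hH x)⟩
  have hi2 : Integrable (fun y => lpKernel φ j (x - y) * F y) := by
    refine ⟨hφ'.aestronglyMeasurable_kernel_mul j hFm x, ?_⟩
    obtain ⟨A, hA⟩ := enorm_lowPass_mul_le hφ hum hvm (j - N)
    refine lt_of_le_of_lt (lintegral_mono fun y => ?_) (hφ'.lintegral_kernel_mul_pow_lt_top j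
      (2 * (n + 1)) (decayMass_const_lt_top (ENNReal.coe_ne_top (r := A))) x)
    rw [enorm_mul]
    exact mul_le_mul_right (hA y) _
  have heq : lpProj φ j (fun y => u y * v y) x
      = ∫ y, lpKernel φ j (x - y) * (u y * v y - F y) := by
    have h0 := lpProj_mul_lpProj_eq_zero hφ' hχ (hN j) hu hv hum hvm x
    rw [lpProj] at h0
    rw [lpProj, ← add_zero (∫ y, lpKernel φ j (x - y) * (u y * v y - F y)), ← h0,
      ← integral_add hi1 hi2]
    congr 1
    ext y
    ring
  rw [heq]
  exact (enorm_integral_le_lintegral_enorm _).trans (hbound.trans (hC j _ x))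

/-- The dyadic form of the weighted Leibniz rule for functions of space. -/
theorem lpProj_mul_bound {φ : ℝ → ℝ} (hφ : IsLittlewoodPaley φ)
    {q₀ q₁ q₂ p₁ p₂ : ℝ≥0∞} (hq₀ : 1 ≤ q₀)
    (hqp₁ : q₀⁻¹ = q₁⁻¹ + p₁⁻¹) (hqp₂ : q₀⁻¹ = q₂⁻¹ + p₂⁻¹)
    {W₀ W₁ W₂ Z₁ Z₂ : E n → ℝ≥0∞} (hW₀ : AEMeasurable W₀ volume)
    (hW₁ : AEMeasurable W₁ volume) (hW₂ : AEMeasurable W₂ volume)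
    (hZ₁ : AEMeasurable Z₁ volume) (hZ₂ : AEMeasurable Z₂ volume)
    (hne : ∀ᵐ x, W₀ x ≠ 0 ∧ W₀ x ≠ ∞)
    (h₁ : ∀ᵐ x, W₀ x = W₁ x * Z₁ x) (h₂ : ∀ᵐ x, W₀ x = W₂ x * Z₂ x)
    (hB₀ : DecayBound q₀ W₀) (hB₁ : DecayBound p₁ Z₁) (hB₂ : DecayBound p₂ Z₂) :
    ∃ (N : ℕ) (C : ℝ≥0), ∀ u v : E n → ℂ, AEStronglyMeasurable u volume →
      AEStronglyMeasurable v volume → decayMass (fun x => ‖u x‖ₑ) < ∞ →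
      decayMass (fun x => ‖v x‖ₑ) < ∞ → ∀ j : ℤ,
      (paraproductBound φ q₁ q₂ p₁ p₂ W₁ W₂ Z₁ Z₂ (j - N) u v < ∞ →
        IsTempered (fun x => u x * v x)) ∧
      eLpNorm (fun x => W₀ x * ‖lpProj φ j (fun y => u y * v y) x‖ₑ) q₀ volume ≤
        C * paraproductBound φ q₁ q₂ p₁ p₂ W₁ W₂ Z₁ Z₂ (j - N) u v := by
  obtain ⟨A, hA⟩ := eLpNorm_paraproductMajorant_le hφ hq₀ hqp₁ hqp₂ hW₀ hW₁ hW₂ hZ₁ hZ₂ h₁ h₂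
    hB₁ hB₂
  obtain ⟨N, B, hB⟩ := enorm_lpProj_mul_le (n := n) hφ
  have hB₀' := hB₀
  obtain ⟨D, hD⟩ := hB₀
  have hq0 : q₀ ≠ 0 := (one_pos.trans_le hq₀).ne'
  -- The `+ 1` keeps the constant nonzero, so that an infinite bound is not turned into `0 · ∞ = 0`.
  refine ⟨N, B * D * A + 1, fun u v hu hv hum hvm j => ?_⟩
  have hHm := aemeasurable_paraproductMajorant hφ hu hv (j - N)
  set G := paraproductBound φ q₁ q₂ p₁ p₂ W₁ W₂ Z₁ Z₂ (j - N) u v with hG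
  have hmass : G < ∞ → decayMass (paraproductMajorant φ (j - N) u v) < ∞ := fun h =>
    hB₀'.decayMass_lt_top hq0 hW₀ hne hHm
      ((hA u v hu hv (j - N)).trans_lt (ENNReal.mul_lt_top ENNReal.coe_lt_top h))
  refine ⟨fun h => isTempered_mul hφ hu hv hum hvm (hmass h), ?_⟩
  rcases eq_or_ne G ∞ with htop | htop
  · rw [htop, ENNReal.mul_top (by simp)]
    exact le_top
  calc _ ≤ B * eLpNorm (fun x => W₀ x *
        decayAvg 1 ((2 : ℝ) ^ j) (paraproductMajorant φ (j - N) u v) x) q₀ volume := by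
        refine eLpNorm_nnreal_mul_le (ae_of_all _ fun x => ?_)
        rw [mul_left_comm]
        exact mul_le_mul_right (hB u v hu hv hum hvm j (hmass (lt_top_iff_ne_top.2 htop)) x) _
    _ ≤ B * (D * (A * G)) := by
        gcongr
        exact (hD _ (by positivity) _ hHm).trans (mul_le_mul_right (hA u v hu hv _) _)
    _ ≤ _ := by
        push_cast
        rw [add_mul]
        refine le_add_right (le_of_eq ?_)
        ring


/-! ### Measurability in time -/

section Measurability

variable {T X : Type*} [MeasurableSpace T] [MeasurableSpace X] {ν : Measure T} {μ : Measure X}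
  [SFinite μ]

/-- The essential supremum is at most `c` exactly when the section of `{c < f}` is null, and
measures of sections are measurable. -/
theorem measurable_essSup_prod {f : T × X → ℝ≥0∞} (hf : Measurable f) :
    Measurable fun t => essSup (fun x => f (t, x)) μ := by
  refine measurable_of_Iic fun c => ?_
  have : (fun t => essSup (fun x => f (t, x)) μ) ⁻¹' Iic c
      = (fun t => μ (Prod.mk t ⁻¹' {z | c < f z})) ⁻¹' {0} := by
    ext t
    simp only [mem_preimage, mem_Iic, mem_singleton_iff]
    constructor
    · intro h
      have h1 := ae_le_essSup (f := fun x => f (t, x)) (μ := μ)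
      refine measure_mono_null (fun x hx => ?_) (ae_iff.1 (h1.mono fun x hx => hx.trans h))
      exact not_le.2 hx
    · intro h
      refine essSup_le_of_ae_le c (ae_iff.2 (measure_mono_null (fun x hx => ?_) h))
      exact not_le.1 hx
  rw [this]
  exact measurable_measure_prodMk_left (measurableSet_lt measurable_const hf)
    (measurableSet_singleton 0)

theorem measurable_eLpNorm_prod (q : ℝ≥0∞) {f : T × X → ℝ≥0∞} (hf : Measurable f) :
    Measurable fun t => eLpNorm (fun x => f (t, x)) q μ := by
  rcases eq_or_ne q 0 with rfl | hq0
  · simp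
  rcases eq_or_ne q ∞ with rfl | hq
  · simp only [eLpNorm_exponent_top, eLpNormEssSup, enorm_eq_self]
    exact measurable_essSup_prod hf
  · simp only [eLpNorm_eq_lintegral_rpow_enorm_toReal hq0 hq, enorm_eq_self]
    exact (Measurable.lintegral_prod_right (ν := μ) (f := fun t x => f (t, x) ^ q.toReal)
      (hf.pow_const _)).pow_const _

theorem aemeasurable_eLpNorm_prod [SFinite ν] (q : ℝ≥0∞) {f : T × X → ℝ≥0∞}
    (hf : AEMeasurable f (ν.prod μ)) :
    AEMeasurable (fun t => eLpNorm (fun x => f (t, x)) q μ) ν := by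
  refine ⟨_, measurable_eLpNorm_prod (μ := μ) q hf.measurable_mk, ?_⟩
  filter_upwards [Measure.ae_ae_of_ae_prod hf.ae_eq_mk] with t ht
  exact eLpNorm_congr_ae ht

end Measurability

/-! ### Weighted norms and their measurability in time -/

theorem wNorm_eq (q : ℝ≥0∞) (w : E n → ℝ) (f : E n → ℂ) :
    wNorm q w f = eLpNorm (fun x => ‖w x‖ₑ * ‖f x‖ₑ) q volume := by
  rw [wNorm, ← eLpNorm_enorm]
  congr 1
  ext x
  rw [enorm_mul]
  congr 1
  simp [enorm_eq_nnnorm]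

theorem wNorm_const_mul (q : ℝ≥0∞) (w : E n → ℝ) (c : ℂ) (f : E n → ℂ) :
    wNorm q w (fun x => c * f x) = ‖c‖ₑ * wNorm q w f := by
  rw [wNorm, wNorm, ← eLpNorm_const_smul]
  congr 1
  ext x
  simp only [Pi.smul_apply, smul_eq_mul]
  ring

theorem aemeasurable_wNorm {ν : Measure ℝ} [SFinite ν] (q : ℝ≥0∞) {w : E n → ℝ} (hw : IsWeight w)
    {u : ℝ → E n → ℂ}
    (hu : AEStronglyMeasurable (fun y : ℝ × E n => u y.1 y.2) (ν.prod volume)) :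
    AEMeasurable (fun t => wNorm q w (u t)) ν := by
  simp only [wNorm_eq]
  refine aemeasurable_eLpNorm_prod q (f := fun y : ℝ × E n => ‖w y.2‖ₑ * ‖u y.1 y.2‖ₑ) ?_
  exact (hw.aemeasurable_enorm.comp_quasiMeasurePreserving
    Measure.quasiMeasurePreserving_snd).mul hu.enorm

theorem IsRadialProfile.aestronglyMeasurable_lpProj_prod {g : ℝ → ℝ} (hg : IsRadialProfile g)
    {ν : Measure ℝ} [SFinite ν] (j : ℤ) {u : ℝ → E n → ℂ}
    (hu : AEStronglyMeasurable (fun y : ℝ × E n => u y.1 y.2) (ν.prod volume)) :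
    AEStronglyMeasurable (fun y : ℝ × E n => lpProj g j (u y.1) y.2) (ν.prod volume) := by
  refine AEStronglyMeasurable.integral_prod_right' (f := fun z : (ℝ × E n) × E n =>
    lpKernel g j (z.1.2 - z.2) * u z.1.1 z.2) ?_
  refine AEStronglyMeasurable.mul ?_ ?_
  · exact ((hg.continuous_lpKernel j).comp (by fun_prop)).aestronglyMeasurable
  · exact hu.comp_quasiMeasurePreserving
      (MeasureTheory.QuasiMeasurePreserving.prodMap Measure.quasiMeasurePreserving_fst
        (Measure.QuasiMeasurePreserving.id volume))

/-! ### Summation over dyadic frequencies -/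

/-- The discrete convolution `∑ₘ θᵐ F(J + m + 1)`. -/
noncomputable def dyadicSum (θ : ℝ≥0∞) (F : ℤ → ℝ≥0∞) (J : ℤ) : ℝ≥0∞ :=
  ∑' m : ℕ, θ ^ m * F (J + m + 1)

theorem eLpNorm_count_add_right (p : ℝ≥0∞) (F : ℤ → ℝ≥0∞) (c : ℤ) :
    eLpNorm (fun j => F (j + c)) p Measure.count = eLpNorm F p Measure.count :=
  eLpNorm_comp_measurePreserving (g := F) (Measurable.of_discrete).aestronglyMeasurable
    (measurePreserving_add_right Measure.count c)

/-- Young's inequality `ℓ¹ * ℓ^λ ⊆ ℓ^λ`: Minkowski's inequality, translation invariance and the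
geometric series. -/
theorem eLpNorm_dyadicSum_le {lam : ℝ≥0∞} (hlam : 1 ≤ lam) {θ : ℝ≥0∞} (hθ : θ ≠ ∞)
    (F : ℤ → ℝ≥0∞) (N : ℤ) :
    eLpNorm (fun j => dyadicSum θ F (j - N)) lam Measure.count ≤
      (1 - θ)⁻¹ * eLpNorm F lam Measure.count := by
  unfold dyadicSum
  refine (eLpNorm_tsum_le hlam fun m => (Measurable.of_discrete).aemeasurable).trans ?_
  rw [← ENNReal.tsum_geometric, ← ENNReal.tsum_mul_right]
  refine ENNReal.tsum_le_tsum fun m => ?_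
  refine (eLpNorm_const_mul_le (by finiteness)).trans ?_
  gcongr
  rw [← eLpNorm_count_add_right lam F (-N + m + 1)]
  refine le_of_eq (congrArg (fun f => eLpNorm f lam Measure.count) (funext fun j => ?_))
  congr 1
  ring

theorem eLpNorm_linear_combination_le {lam : ℝ≥0∞} (hlam : 1 ≤ lam) (a b : ℤ → ℝ≥0∞)
    {A B : ℝ≥0∞} (hA : A ≠ ∞) (hB : B ≠ ∞) :
    eLpNorm (fun k => a k * B + b k * A) lam Measure.count ≤
      eLpNorm a lam Measure.count * B + eLpNorm b lam Measure.count * A := by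
  refine (eLpNorm_add_le_ennreal hlam (Measurable.of_discrete).aemeasurable
    (Measurable.of_discrete).aemeasurable).trans ?_
  simp only [mul_comm _ B, mul_comm _ A]
  exact add_le_add (eLpNorm_const_mul_le hB) (eLpNorm_const_mul_le hA)

theorem eLpNorm_dyadicSum_combination_le {lam : ℝ≥0∞} (hlam : 1 ≤ lam) {θ : ℝ≥0∞} (hθ : θ ≠ ∞)
    (a b : ℤ → ℝ≥0∞) {A B : ℝ≥0∞} (hA : A ≠ ∞) (hB : B ≠ ∞) (N : ℤ) :
    eLpNorm (fun j => dyadicSum θ (fun k => a k * B + b k * A) (j - N)) lam Measure.count ≤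
      (1 - θ)⁻¹ * (eLpNorm a lam Measure.count * B + eLpNorm b lam Measure.count * A) :=
  (eLpNorm_dyadicSum_le hlam hθ _ N).trans
    (mul_le_mul_right (eLpNorm_linear_combination_le hlam a b hA hB) _)

/-- The weighted norm `‖w 2^{js} P_j f‖_{L^q}` of a dyadic piece. -/
noncomputable def dyadicNorm (φ : ℝ → ℝ) (s : ℝ) (q : ℝ≥0∞) (w : E n → ℝ) (f : E n → ℂ)
    (j : ℤ) : ℝ≥0∞ :=
  wNorm q w (fun x => (((2 : ℝ) ^ ((j : ℝ) * s) : ℝ) : ℂ) * lpProj φ j f x)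

theorem dyadicNorm_eq (φ : ℝ → ℝ) (s : ℝ) (q : ℝ≥0∞) (w : E n → ℝ) (f : E n → ℂ) (j : ℤ) :
    dyadicNorm φ s q w f j = ENNReal.ofReal ((2 : ℝ) ^ ((j : ℝ) * s)) *
      eLpNorm (fun x => ‖w x‖ₑ * ‖lpProj φ j f x‖ₑ) q volume := by
  rw [dyadicNorm, wNorm_const_mul, wNorm_eq, ← enorm_of_pos (by positivity)]
  congr 1
  simp [enorm_eq_nnnorm]

/-- With `k = j - N + m + 1` one has `2^{js} = 2^{Ns} 2^{-(m+1)s} 2^{ks}`; the surplus factor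
`2^{-s} ≤ 1` is dropped. -/
theorem ofReal_mul_paraproductBound_le (φ : ℝ → ℝ) {s : ℝ} (hs : 0 < s) (q₁ q₂ p₁ p₂ : ℝ≥0∞)
    (w₁ w₂ z₁ z₂ : E n → ℝ) (N : ℕ) (j : ℤ) (u v : E n → ℂ) :
    ENNReal.ofReal ((2 : ℝ) ^ ((j : ℝ) * s)) *
      paraproductBound φ q₁ q₂ p₁ p₂ (fun x => ‖w₁ x‖ₑ) (fun x => ‖w₂ x‖ₑ) (fun x => ‖z₁ x‖ₑ)
        (fun x => ‖z₂ x‖ₑ) (j - N) u v ≤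
    ENNReal.ofReal ((2 : ℝ) ^ ((N : ℝ) * s)) *
      dyadicSum (ENNReal.ofReal ((2 : ℝ) ^ (-s))) (fun k => dyadicNorm φ s q₁ w₁ u k *
        wNorm p₁ z₁ v + dyadicNorm φ s q₂ w₂ v k * wNorm p₂ z₂ u) (j - N) := by
  rw [paraproductBound, dyadicSum, ← ENNReal.tsum_mul_left, ← ENNReal.tsum_mul_left]
  refine ENNReal.tsum_le_tsum fun m => ?_
  rw [dyadicNorm_eq, dyadicNorm_eq, ← wNorm_eq p₁, ← wNorm_eq p₂]
  set k : ℤ := j - N + m + 1 with hk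
  have h : ENNReal.ofReal ((2 : ℝ) ^ ((j : ℝ) * s)) ≤ ENNReal.ofReal ((2 : ℝ) ^ ((N : ℝ) * s)) *
      ENNReal.ofReal ((2 : ℝ) ^ (-s)) ^ m * ENNReal.ofReal ((2 : ℝ) ^ ((k : ℝ) * s)) := by
    rw [← ENNReal.ofReal_pow (by positivity), ← ENNReal.ofReal_mul (by positivity),
      ← ENNReal.ofReal_mul (by positivity), ← Real.rpow_natCast, ← Real.rpow_mul (by norm_num),
      ← Real.rpow_add (by norm_num), ← Real.rpow_add (by norm_num)]
    refine ENNReal.ofReal_le_ofReal (Real.rpow_le_rpow_of_exponent_le one_le_two ?_)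
    rw [hk]
    push_cast
    nlinarith
  refine (mul_le_mul_left h _).trans_eq ?_
  ring

/-- The dyadic form of the weighted Leibniz rule for functions of space, with the powers `2^{js}`
and the Muckenhoupt conditions of the theorem. -/
theorem dyadicNorm_mul_le {φ : ℝ → ℝ} (hφ : IsLittlewoodPaley φ) {s : ℝ} (hs : 0 < s)
    {q₀ q₁ q₂ p₁ p₂ : ℝ≥0∞} (hq₀ : 1 ≤ q₀)
    (hqp₁ : q₀⁻¹ = q₁⁻¹ + p₁⁻¹) (hqp₂ : q₀⁻¹ = q₂⁻¹ + p₂⁻¹)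
    {w₀ w₁ w₂ z₁ z₂ : E n → ℝ} (hw₀ : IsWeight w₀) (hw₁ : IsWeight w₁) (hw₂ : IsWeight w₂)
    (hz₁ : IsWeight z₁) (hz₂ : IsWeight z₂)
    (h₁ : ∀ᵐ x, w₀ x = w₁ x * z₁ x) (h₂ : ∀ᵐ x, w₀ x = w₂ x * z₂ x)
    (hB₀ : DecayBound q₀ fun x => ‖w₀ x‖ₑ) (hB₁ : DecayBound p₁ fun x => ‖z₁ x‖ₑ)
    (hB₂ : DecayBound p₂ fun x => ‖z₂ x‖ₑ) :
    ∃ (N : ℕ) (C : ℝ≥0), ∀ u v : E n → ℂ, AEStronglyMeasurable u volume →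
      AEStronglyMeasurable v volume → decayMass (fun x => ‖u x‖ₑ) < ∞ →
      decayMass (fun x => ‖v x‖ₑ) < ∞ → ∀ j : ℤ,
      (dyadicSum (ENNReal.ofReal ((2 : ℝ) ^ (-s))) (fun k => dyadicNorm φ s q₁ w₁ u k *
        wNorm p₁ z₁ v + dyadicNorm φ s q₂ w₂ v k * wNorm p₂ z₂ u) (j - N) < ∞ →
        IsTempered (fun x => u x * v x)) ∧
      dyadicNorm φ s q₀ w₀ (fun x => u x * v x) j ≤
        C * dyadicSum (ENNReal.ofReal ((2 : ℝ) ^ (-s))) (fun k => dyadicNorm φ s q₁ w₁ u k *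
          wNorm p₁ z₁ v + dyadicNorm φ s q₂ w₂ v k * wNorm p₂ z₂ u) (j - N) := by
  obtain ⟨N, C, hC⟩ := lpProj_mul_bound hφ hq₀ hqp₁ hqp₂ hw₀.aemeasurable_enorm
    hw₁.aemeasurable_enorm hw₂.aemeasurable_enorm hz₁.aemeasurable_enorm hz₂.aemeasurable_enorm
    hw₀.enorm_ne (h₁.mono fun x hx => by rw [hx, enorm_mul])
    (h₂.mono fun x hx => by rw [hx, enorm_mul]) hB₀ hB₁ hB₂
  refine ⟨N, C * ((2 : ℝ) ^ ((N : ℝ) * s)).toNNReal, fun u v hu hv hum hvm j => ?_⟩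
  obtain ⟨ht, hle⟩ := hC u v hu hv hum hvm j
  have hbound := ofReal_mul_paraproductBound_le φ hs q₁ q₂ p₁ p₂ w₁ w₂ z₁ z₂ N j u v
  refine ⟨fun hfin => ht ?_, ?_⟩
  · have h3 := hbound.trans_lt (ENNReal.mul_lt_top ENNReal.ofReal_lt_top hfin)
    refine (ENNReal.mul_lt_top_iff.1 h3).elim (fun h => h.2) fun h => h.elim (fun h => ?_) fun h => ?_
    · rw [ENNReal.ofReal_eq_zero] at h
      exact absurd h (not_le.2 (by positivity))
    · rw [h]
      exact ENNReal.zero_lt_top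
  · rw [dyadicNorm_eq]
    calc _ ≤ ENNReal.ofReal ((2 : ℝ) ^ ((j : ℝ) * s)) * (C * _) := mul_le_mul_right hle _
      _ = C * (ENNReal.ofReal ((2 : ℝ) ^ ((j : ℝ) * s)) * _) := mul_left_comm _ _ _
      _ ≤ _ := by
        rw [ENNReal.coe_mul, mul_assoc]
        exact mul_le_mul_right hbound _


/-! ### The weighted Leibniz rule -/

theorem decayMass_of_wNorm_lt_top {p : ℝ≥0∞} (hp : 1 < p) {z : E n → ℝ} (hz : IsWeight z)
    (hB : DecayBound p fun x => ‖z x‖ₑ) {f : E n → ℂ} (hf : AEStronglyMeasurable f volume)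
    (h : wNorm p z f < ∞) : decayMass (fun x => ‖f x‖ₑ) < ∞ :=
  hB.decayMass_lt_top (one_pos.trans hp).ne' hz.aemeasurable_enorm hz.enorm_ne hf.enorm
    (by rwa [← wNorm_eq])

theorem one_sub_rpow_inv_ne_top {s : ℝ} (hs : 0 < s) :
    (1 - ENNReal.ofReal ((2 : ℝ) ^ (-s)))⁻¹ ≠ ∞ := by
  have h : ENNReal.ofReal ((2 : ℝ) ^ (-s)) < 1 := by
    rw [← ENNReal.ofReal_one, ENNReal.ofReal_lt_ofReal_iff one_pos]
    exact Real.rpow_lt_one_of_one_lt_of_neg one_lt_two (by linarith)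
  simpa [tsub_eq_zero_iff_le] using h

theorem spatial_leibniz
    {φ : ℝ → ℝ} (hφ : IsLittlewoodPaley φ) {s : ℝ} (hs : 0 < s) {lam : ℝ≥0∞} (hlam : 1 ≤ lam)
    {q₀ q₁ q₂ p₁ p₂ : ℝ≥0∞} (hq₀ : 1 ≤ q₀) (hp₁ : 1 < p₁) (hp₂ : 1 < p₂)
    (hqp₁ : q₀⁻¹ = q₁⁻¹ + p₁⁻¹) (hqp₂ : q₀⁻¹ = q₂⁻¹ + p₂⁻¹)
    {w₀ w₁ w₂ z₁ z₂ : E n → ℝ} (hw₀ : IsWeight w₀) (hw₁ : IsWeight w₁) (hw₂ : IsWeight w₂)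
    (hz₁ : IsWeight z₁) (hz₂ : IsWeight z₂)
    (h₁ : ∀ᵐ x, w₀ x = w₁ x * z₁ x) (h₂ : ∀ᵐ x, w₀ x = w₂ x * z₂ x)
    (hB₀ : DecayBound q₀ fun x => ‖w₀ x‖ₑ) (hB₁ : DecayBound p₁ fun x => ‖z₁ x‖ₑ)
    (hB₂ : DecayBound p₂ fun x => ‖z₂ x‖ₑ) :
    ∃ C : ℝ≥0, ∀ u v : E n → ℂ,
      AEStronglyMeasurable u volume → AEStronglyMeasurable v volume →
      wNorm p₁ z₁ v < ∞ → wNorm p₂ z₂ u < ∞ →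
      IsTempered u ∧ IsTempered v ∧
      (wBesov φ s lam q₁ w₁ u * wNorm p₁ z₁ v + wBesov φ s lam q₂ w₂ v * wNorm p₂ z₂ u < ∞ →
        IsTempered (fun x => u x * v x)) ∧
      wBesov φ s lam q₀ w₀ (fun x => u x * v x)
        ≤ C * (wBesov φ s lam q₁ w₁ u * wNorm p₁ z₁ v
            + wBesov φ s lam q₂ w₂ v * wNorm p₂ z₂ u) := by
  obtain ⟨N, C, hC⟩ := dyadicNorm_mul_le hφ hs hq₀ hqp₁ hqp₂ hw₀ hw₁ hw₂ hz₁ hz₂ h₁ h₂ hB₀ hB₁ hB₂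
  have hK := one_sub_rpow_inv_ne_top hs
  refine ⟨C * (1 - ENNReal.ofReal ((2 : ℝ) ^ (-s)))⁻¹.toNNReal, fun u v hu hv hvz huz => ?_⟩
  have hum := decayMass_of_wNorm_lt_top hp₂ hz₂ hB₂ hu huz
  have hvm := decayMass_of_wNorm_lt_top hp₁ hz₁ hB₁ hv hvz
  have hsum := eLpNorm_dyadicSum_combination_le hlam
    (ENNReal.ofReal_ne_top (r := (2 : ℝ) ^ (-s))) (dyadicNorm φ s q₁ w₁ u)
    (dyadicNorm φ s q₂ w₂ v) huz.ne hvz.ne N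
  refine ⟨isTempered_of_decayMass hu hum, isTempered_of_decayMass hv hvm, fun hfin => ?_, ?_⟩
  -- One frequency is enough: a finite `ℓ^λ` norm bounds the term `j = 0`.
  · refine (hC u v hu hv hum hvm 0).1 ?_
    refine lt_of_le_of_lt ?_ (hsum.trans_lt (ENNReal.mul_lt_top hK.lt_top hfin))
    exact enorm_le_eLpNorm_count (ε := ℝ≥0∞) _ (0 : ℤ) (one_pos.trans_le hlam).ne'
  · calc wBesov φ s lam q₀ w₀ (fun x => u x * v x) ≤ C * _ :=
          eLpNorm_nnreal_mul_le (ae_of_all _ fun j => (hC u v hu hv hum hvm j).2)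
      _ ≤ C * _ := mul_le_mul_right hsum _
      _ = _ := by
          rw [ENNReal.coe_mul, ENNReal.coe_toNNReal hK, mul_assoc]
          rfl

/-- The spatial dyadic estimate is used at almost every time. Since the time norm stands inside
`ℓ^λ`, Minkowski's inequality moves it into the sum over `m`, and Hölder's inequality in time
separates the factors for each frequency; the summation over `j` is then the spatial one. -/
theorem spacetime_leibniz
    {φ : ℝ → ℝ} (hφ : IsLittlewoodPaley φ) {s : ℝ} (hs : 0 < s) {lam : ℝ≥0∞} (hlam : 1 ≤ lam)
    {q₀ q₁ q₂ p₁ p₂ : ℝ≥0∞} (hq₀ : 1 ≤ q₀) (hp₁ : 1 < p₁) (hp₂ : 1 < p₂)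
    (hqp₁ : q₀⁻¹ = q₁⁻¹ + p₁⁻¹) (hqp₂ : q₀⁻¹ = q₂⁻¹ + p₂⁻¹)
    {w₀ w₁ w₂ z₁ z₂ : E n → ℝ} (hw₀ : IsWeight w₀) (hw₁ : IsWeight w₁) (hw₂ : IsWeight w₂)
    (hz₁ : IsWeight z₁) (hz₂ : IsWeight z₂)
    (h₁ : ∀ᵐ x, w₀ x = w₁ x * z₁ x) (h₂ : ∀ᵐ x, w₀ x = w₂ x * z₂ x)
    (hB₀ : DecayBound q₀ fun x => ‖w₀ x‖ₑ) (hB₁ : DecayBound p₁ fun x => ‖z₁ x‖ₑ)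
    (hB₂ : DecayBound p₂ fun x => ‖z₂ x‖ₑ)
    {s₀ s₁ s₂ s₃ s₄ : ℝ≥0∞} (hs₀ : 1 ≤ s₀) (hs₂ : 1 ≤ s₂) (hs₄ : 1 ≤ s₄)
    (hs₁₂ : s₀⁻¹ = s₁⁻¹ + s₂⁻¹) (hs₃₄ : s₀⁻¹ = s₃⁻¹ + s₄⁻¹) :
    ∃ C : ℝ≥0, ∀ I : Set ℝ, MeasurableSet I → ∀ u v : ℝ → E n → ℂ,
      AEStronglyMeasurable (fun y : ℝ × E n => u y.1 y.2) ((volume.restrict I).prod volume) →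
      AEStronglyMeasurable (fun y : ℝ × E n => v y.1 y.2) ((volume.restrict I).prod volume) →
      wMixedNorm I s₂ p₁ z₁ v < ∞ → wMixedNorm I s₄ p₂ z₂ u < ∞ →
      (∀ᵐ t ∂(volume.restrict I), IsTempered (u t) ∧ IsTempered (v t)) ∧
      (wMixedBesov φ I s lam s₁ q₁ w₁ u * wMixedNorm I s₂ p₁ z₁ v
          + wMixedBesov φ I s lam s₃ q₂ w₂ v * wMixedNorm I s₄ p₂ z₂ u < ∞ →
        ∀ᵐ t ∂(volume.restrict I), IsTempered (fun x => u t x * v t x)) ∧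
      wMixedBesov φ I s lam s₀ q₀ w₀ (fun t x => u t x * v t x)
        ≤ C * (wMixedBesov φ I s lam s₁ q₁ w₁ u * wMixedNorm I s₂ p₁ z₁ v
            + wMixedBesov φ I s lam s₃ q₂ w₂ v * wMixedNorm I s₄ p₂ z₂ u) := by
  obtain ⟨N, C, hC⟩ := dyadicNorm_mul_le hφ hs hq₀ hqp₁ hqp₂ hw₀ hw₁ hw₂ hz₁ hz₂ h₁ h₂ hB₀ hB₁ hB₂
  have hK := one_sub_rpow_inv_ne_top hs
  refine ⟨C * (1 - ENNReal.ofReal ((2 : ℝ) ^ (-s)))⁻¹.toNNReal, fun I _ u v hu hv hvz huz => ?_⟩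
  have hφ' := hφ.isRadialProfile
  set ν := volume.restrict I with hν
  set θ := ENNReal.ofReal ((2 : ℝ) ^ (-s)) with hθ
  have hs0 : s₀ ≠ 0 := (one_pos.trans_le hs₀).ne'
  have mv : AEMeasurable (fun t => wNorm p₁ z₁ (v t)) ν := aemeasurable_wNorm p₁ hz₁ hv
  have mu : AEMeasurable (fun t => wNorm p₂ z₂ (u t)) ν := aemeasurable_wNorm p₂ hz₂ hu
  have mdyadic : ∀ (q : ℝ≥0∞) {w : E n → ℝ}, IsWeight w → ∀ {f : ℝ → E n → ℂ},
      AEStronglyMeasurable (fun y : ℝ × E n => f y.1 y.2) (ν.prod volume) → ∀ k : ℤ,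
      AEMeasurable (fun t => dyadicNorm φ s q w (f t) k) ν := fun q w hw f hf k =>
    aemeasurable_wNorm q hw ((hφ'.aestronglyMeasurable_lpProj_prod k hf).const_mul _)
  have mF : ∀ k : ℤ, AEMeasurable (fun t => dyadicNorm φ s q₁ w₁ (u t) k * wNorm p₁ z₁ (v t) +
      dyadicNorm φ s q₂ w₂ (v t) k * wNorm p₂ z₂ (u t)) ν := fun k =>
    ((mdyadic q₁ hw₁ hu k).mul mv).add ((mdyadic q₂ hw₂ hv k).mul mu)
  -- Finite mixed norms of `z₁ v` and `z₂ u` make almost every time slice admissible for the spatial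
  -- estimate.
  have hslice : ∀ᵐ t ∂ν, AEStronglyMeasurable (u t) volume ∧ AEStronglyMeasurable (v t) volume ∧
      decayMass (fun x => ‖u t x‖ₑ) < ∞ ∧ decayMass (fun x => ‖v t x‖ₑ) < ∞ := by
    filter_upwards [hu.prodMk_left, hv.prodMk_left,
      ae_lt_top_of_eLpNorm_lt_top (one_pos.trans_le hs₂).ne' mv hvz,
      ae_lt_top_of_eLpNorm_lt_top (one_pos.trans_le hs₄).ne' mu huz] with t hut hvt hvt' hut'
    exact ⟨hut, hvt, decayMass_of_wNorm_lt_top hp₂ hz₂ hB₂ hut hut',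
      decayMass_of_wNorm_lt_top hp₁ hz₁ hB₁ hvt hvt'⟩
  set a : ℤ → ℝ≥0∞ := fun k => eLpNorm (fun t => dyadicNorm φ s q₁ w₁ (u t) k) s₁ ν with ha
  set b : ℤ → ℝ≥0∞ := fun k => eLpNorm (fun t => dyadicNorm φ s q₂ w₂ (v t) k) s₃ ν with hb
  set B := wMixedNorm I s₂ p₁ z₁ v with hBdef
  set A := wMixedNorm I s₄ p₂ z₂ u with hAdef
  have hG : ∀ J : ℤ, eLpNorm (fun t => dyadicSum θ (fun k => dyadicNorm φ s q₁ w₁ (u t) k *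
      wNorm p₁ z₁ (v t) + dyadicNorm φ s q₂ w₂ (v t) k * wNorm p₂ z₂ (u t)) J) s₀ ν ≤
      dyadicSum θ (fun k => a k * B + b k * A) J := by
    intro J
    unfold dyadicSum
    refine (eLpNorm_tsum_le hs₀ fun m => (mF _).const_mul _).trans
      (ENNReal.tsum_le_tsum fun m => ?_)
    refine (eLpNorm_const_mul_le (by finiteness)).trans (mul_le_mul_right ?_ _)
    refine (eLpNorm_add_le_ennreal hs₀ ((mdyadic q₁ hw₁ hu _).mul mv)
      ((mdyadic q₂ hw₂ hv _).mul mu)).trans (add_le_add ?_ ?_)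
    · exact eLpNorm_mul_le hs₁₂ hs0 (mdyadic q₁ hw₁ hu _) mv
    · exact eLpNorm_mul_le hs₃₄ hs0 (mdyadic q₂ hw₂ hv _) mu
  have hsum := eLpNorm_dyadicSum_combination_le hlam
    (ENNReal.ofReal_ne_top (r := (2 : ℝ) ^ (-s))) a b huz.ne hvz.ne N
  refine ⟨hslice.mono fun t ht => ⟨isTempered_of_decayMass ht.1 ht.2.2.1,
    isTempered_of_decayMass ht.2.1 ht.2.2.2⟩, fun hfin => ?_, ?_⟩
  · have h0 : dyadicSum θ (fun k => a k * B + b k * A) (0 - N) < ∞ := by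
      refine lt_of_le_of_lt ?_ (hsum.trans_lt (ENNReal.mul_lt_top hK.lt_top hfin))
      exact enorm_le_eLpNorm_count (ε := ℝ≥0∞)
        (fun j : ℤ => dyadicSum θ (fun k => a k * B + b k * A) (j - N)) (0 : ℤ)
        (one_pos.trans_le hlam).ne'
    have mG : AEMeasurable (fun t => dyadicSum θ (fun k => dyadicNorm φ s q₁ w₁ (u t) k *
        wNorm p₁ z₁ (v t) + dyadicNorm φ s q₂ w₂ (v t) k * wNorm p₂ z₂ (u t)) (0 - N)) ν :=
      AEMeasurable.tsum fun m => (mF _).const_mul _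
    filter_upwards [hslice, ae_lt_top_of_eLpNorm_lt_top hs0 mG ((hG _).trans_lt h0)] with t ht hGt
    exact (hC (u t) (v t) ht.1 ht.2.1 ht.2.2.1 ht.2.2.2 0).1 hGt
  · calc wMixedBesov φ I s lam s₀ q₀ w₀ (fun t x => u t x * v t x) ≤ C * _ := by
          refine eLpNorm_nnreal_mul_le (g := fun j : ℤ =>
            dyadicSum θ (fun k => a k * B + b k * A) (j - N)) (ae_of_all _ fun j => ?_)
          refine le_trans (eLpNorm_nnreal_mul_le (C := C) ?_) (mul_le_mul_right (hG _) _)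
          filter_upwards [hslice] with t ht
          exact (hC (u t) (v t) ht.1 ht.2.1 ht.2.2.1 ht.2.2.2 j).2
      _ ≤ C * _ := mul_le_mul_right hsum _
      _ = _ := by
          rw [ENNReal.coe_mul, ENNReal.coe_toNNReal hK, mul_assoc]
          rfl

end WeightedLeibniz

/-! ### The theorem, from Muckenhoupt conditions to bounds for averages -/

theorem theorem2p4
    (n : ℕ) (hn : 1 ≤ n)
    (φ : ℝ → ℝ) (hφ : WeightedLeibniz.IsLittlewoodPaley φ)
    (s : ℝ) (hs : 0 < s) (lam : ℝ≥0∞) (hlam : 1 ≤ lam)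
    (q₀ q₁ q₂ p₁ p₂ : ℝ≥0∞)
    (hq₀ : 1 < q₀ ∧ q₀ < ∞) (hq₁ : 1 < q₁ ∧ q₁ < ∞) (hq₂ : 1 < q₂ ∧ q₂ < ∞)
    (hp₁ : 1 < p₁) (hp₂ : 1 < p₂)
    (hqp₁ : q₀⁻¹ = q₁⁻¹ + p₁⁻¹) (hqp₂ : q₀⁻¹ = q₂⁻¹ + p₂⁻¹)
    (w₀ w₁ w₂ z₁ z₂ : WeightedLeibniz.E n → ℝ)
    (hw₀ : WeightedLeibniz.IsWeight w₀) (hw₁ : WeightedLeibniz.IsWeight w₁)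
    (hw₂ : WeightedLeibniz.IsWeight w₂)
    (hz₁ : WeightedLeibniz.IsWeight z₁) (hz₂ : WeightedLeibniz.IsWeight z₂)
    (hwz₁ : ∀ᵐ x, w₀ x = w₁ x * z₁ x) (hwz₂ : ∀ᵐ x, w₀ x = w₂ x * z₂ x)
    (hAw₀ : WeightedLeibniz.MuckenhouptA q₀.toReal (fun x => w₀ x ^ q₀.toReal))
    (hAw₁ : WeightedLeibniz.MuckenhouptA q₁.toReal (fun x => w₁ x ^ q₁.toReal))
    (hAw₂ : WeightedLeibniz.MuckenhouptA q₂.toReal (fun x => w₂ x ^ q₂.toReal))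
    (hAz₁ : WeightedLeibniz.AdmissibleFactorWeight p₁ z₁)
    (hAz₂ : WeightedLeibniz.AdmissibleFactorWeight p₂ z₂) :
    -- the space-time estimate
    (∀ s₀ s₁ s₂ s₃ s₄ : ℝ≥0∞, 1 ≤ s₀ → 1 ≤ s₁ → 1 ≤ s₂ → 1 ≤ s₃ → 1 ≤ s₄ →
      s₀⁻¹ = s₁⁻¹ + s₂⁻¹ → s₀⁻¹ = s₃⁻¹ + s₄⁻¹ →
      ∃ C : ℝ≥0, ∀ I : Set ℝ, MeasurableSet I → ∀ u v : ℝ → WeightedLeibniz.E n → ℂ,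
        AEStronglyMeasurable (fun y : ℝ × WeightedLeibniz.E n => u y.1 y.2)
          ((volume.restrict I).prod volume) →
        AEStronglyMeasurable (fun y : ℝ × WeightedLeibniz.E n => v y.1 y.2)
          ((volume.restrict I).prod volume) →
        WeightedLeibniz.wMixedNorm I s₂ p₁ z₁ v < ∞ →
        WeightedLeibniz.wMixedNorm I s₄ p₂ z₂ u < ∞ →
        -- the Littlewood-Paley projections of `u` and `v` are well defined, and so are those of
        -- `u v` if the right-hand side below is finite
        (∀ᵐ t ∂(volume.restrict I),
          WeightedLeibniz.IsTempered (u t) ∧ WeightedLeibniz.IsTempered (v t)) ∧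
        (WeightedLeibniz.wMixedBesov φ I s lam s₁ q₁ w₁ u
              * WeightedLeibniz.wMixedNorm I s₂ p₁ z₁ v
            + WeightedLeibniz.wMixedBesov φ I s lam s₃ q₂ w₂ v
              * WeightedLeibniz.wMixedNorm I s₄ p₂ z₂ u < ∞ →
          ∀ᵐ t ∂(volume.restrict I), WeightedLeibniz.IsTempered (fun x => u t x * v t x)) ∧
        WeightedLeibniz.wMixedBesov φ I s lam s₀ q₀ w₀ (fun t x => u t x * v t x)
          ≤ C * (WeightedLeibniz.wMixedBesov φ I s lam s₁ q₁ w₁ u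
                * WeightedLeibniz.wMixedNorm I s₂ p₁ z₁ v
              + WeightedLeibniz.wMixedBesov φ I s lam s₃ q₂ w₂ v
                * WeightedLeibniz.wMixedNorm I s₄ p₂ z₂ u)) ∧
    -- the estimate for functions which do not depend on time
    (∃ C : ℝ≥0, ∀ u v : WeightedLeibniz.E n → ℂ,
        AEStronglyMeasurable u volume → AEStronglyMeasurable v volume →
        WeightedLeibniz.wNorm p₁ z₁ v < ∞ → WeightedLeibniz.wNorm p₂ z₂ u < ∞ →
        WeightedLeibniz.IsTempered u ∧ WeightedLeibniz.IsTempered v ∧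
        (WeightedLeibniz.wBesov φ s lam q₁ w₁ u * WeightedLeibniz.wNorm p₁ z₁ v
            + WeightedLeibniz.wBesov φ s lam q₂ w₂ v * WeightedLeibniz.wNorm p₂ z₂ u < ∞ →
          WeightedLeibniz.IsTempered (fun x => u x * v x)) ∧
        WeightedLeibniz.wBesov φ s lam q₀ w₀ (fun x => u x * v x)
          ≤ C * (WeightedLeibniz.wBesov φ s lam q₁ w₁ u * WeightedLeibniz.wNorm p₁ z₁ v
              + WeightedLeibniz.wBesov φ s lam q₂ w₂ v * WeightedLeibniz.wNorm p₂ z₂ u)) := by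
  have h1q₀ : 1 ≤ q₀ := hq₀.1.le
  have hB₀ := hw₀.decayBound_of_muckenhouptA hq₀.1 hq₀.2 hAw₀
  have hB₁ := hz₁.decayBound_of_admissible hp₁ hAz₁
  have hB₂ := hz₂.decayBound_of_admissible hp₂ hAz₂
  exact ⟨fun s₀ s₁ s₂ s₃ s₄ hs₀ hs₁ hs₂ hs₃ hs₄ hs₁₂ hs₃₄ =>
      WeightedLeibniz.spacetime_leibniz hφ hs hlam h1q₀ hp₁ hp₂ hqp₁ hqp₂ hw₀ hw₁ hw₂ hz₁ hz₂ hwz₁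
        hwz₂ hB₀ hB₁ hB₂ hs₀ hs₂ hs₄ hs₁₂ hs₃₄,
    WeightedLeibniz.spatial_leibniz hφ hs hlam h1q₀ hp₁ hp₂ hqp₁ hqp₂ hw₀ hw₁ hw₂ hz₁ hz₂ hwz₁
      hwz₂ hB₀ hB₁ hB₂⟩
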